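/- Let $c\ge 1$, let $p$ be a prime with $p\ge c$, and let $L=\mathfrak f_{c,2}(\mathbb F_p)=L_1\oplus\dots\oplus L_c$ be the free class-$c$ nilpotent $\mathbb F_p$-Lie algebra on two generators $X_1,X_2$, where $L_k$ is the span of the Lie monomials of weight $k$ in $X_1,X_2$; put $d_k=\dim L_k$. Let $\phi_i(u)=[X_i,u]$ for $i=1,2$, and for a subspace $V\le L_k$ let $\phi(V)=\phi_1(V)+\phi_2(V)$. Put $\Lambda_{k+1}=\phi_1(L_k)\cap\phi_2(L_k)$ and $l_{k+1}=\dim\Lambda_{k+1}$. Let $f_k(m,i,p)$ be the number of subspaces $V\le L_k$ with $\dim V=m$ and $\dim(\phi_1(V)\cap\phi_2(V))=i$, and let $\tilde f_k(m,i,p)$ be the number of subspaces $V\le L_k$ with $\dim V=m$ and $\dim\phi(V)=2m-i$. For integers $n,i$ let $\binom{n}{i}_p$ be the Gaussian binomial coefficient, with $\binom n0_p=1$ for every $n$, and $\binom ni_p=0$ if $i<0$ or if $i>n$ and $i\neq0$. For $k\le c-2$ and $a\ge 0$ let $\alpha_2(a,k,p)$ be the number of ideals $I$ of $L$ of the form $I=I_k\oplus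 I_{k+1}\oplus I_{k+2}\oplus L_{k+3}\oplus\dots\oplus L_c$ with $I_j\le L_j$ and $\dim I_k+\dim I_{k+1}+\dim I_{k+2}=a$. Write $$S_k(a,m,i)=\sum_{m'=2m-i}^{d_{k+1}}\binom{d_{k+1}-(2m-i)}{m'-(2m-i)}_p\binom{d_{k+2}-2m'}{a-m-m'-2m'}_p .$$ Theorem. Let $k\in\{1,3,5\}$, $c\ge k+2$, and let $p\ge c$ be prime. Then $\Lambda_{k+2}=0$ and $$\alpha_2(a,k,p)=\sum_{m=0}^{d_k}\sum_{i=0}^{2m}\tilde f_k(m,i,p)\,S_k(a,m,i).$$ If $k\in\{3,5\}$, then moreover $$\alpha_2(a,k,p)=\sum_{m=0}^{d_k}\sum_{i=0}^{l_{k+1}}f_k(m,i,p)\,S_k(a,m,i).$$ In particular $\alpha_2(a,k,p)$ is uniformly given by a polynomial in $p$: for each $k\in\{1,3,5\}$ and $a\ge0$ there is $P\in\mathbb Q[X]$ such that $\alpha_2(a,k,p)=P(p)$ for all $c\ge k+2$ and all primes $p\ge c$. -/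

import Mathlib

noncomputable section

namespace TwoStep

open Finset

/-- The free nilpotent Lie algebra of class `c` on two generators over `𝔽_p`:
the free Lie algebra modulo the `(c+1)`-st term of its lower central series
(Mathlib numbers this series from `0`, so that term is `lowerCentralSeries _ _ _ c`). -/
abbrev FreeNilp (p c : ℕ) : Type :=
  FreeLieAlgebra (ZMod p) (Fin 2) ⧸
    LieModule.lowerCentralSeries (ZMod p) (FreeLieAlgebra (ZMod p) (Fin 2))
      (FreeLieAlgebra (ZMod p) (Fin 2)) c

/-- The images of the two free generators. -/
def gen (p c : ℕ) (i : Fin 2) : FreeNilp p c :=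
  LieSubmodule.Quotient.mk (FreeLieAlgebra.of (ZMod p) i)

/-- `IsMonomial p c k u`: `u` is an (arbitrarily bracketed) Lie monomial of weight `k`
in the generators. -/
inductive IsMonomial (p c : ℕ) : ℕ → FreeNilp p c → Prop
  | gen (i : Fin 2) : IsMonomial p c 1 (gen p c i)
  | bracket {m n : ℕ} {u v : FreeNilp p c} :
      IsMonomial p c m u → IsMonomial p c n v → IsMonomial p c (m + n) ⁅u, v⁆

/-- The homogeneous component `L_k` of weight `k`. -/
def layer (p c k : ℕ) : Submodule (ZMod p) (FreeNilp p c) :=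
  Submodule.span (ZMod p) {u | IsMonomial p c k u}

/-- `d_k = dim L_k`. -/
def layerDim (p c k : ℕ) : ℕ := Module.finrank (ZMod p) (layer p c k)

/-- `φ_i : u ↦ [X_i, u]`. -/
def phi (p c : ℕ) (i : Fin 2) : FreeNilp p c →ₗ[ZMod p] FreeNilp p c :=
  (LieAlgebra.ad (ZMod p) (FreeNilp p c) (gen p c i) :
    Module.End (ZMod p) (FreeNilp p c))

/-- `φ₁(V) ∩ φ₂(V)`. Its dimension is the dimension of collapse of `V`. -/
def collapse (p c : ℕ) (V : Submodule (ZMod p) (FreeNilp p c)) :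
    Submodule (ZMod p) (FreeNilp p c) :=
  V.map (phi p c 0) ⊓ V.map (phi p c 1)

/-- `φ(V) = φ₁(V) + φ₂(V)`. -/
def phiSum (p c : ℕ) (V : Submodule (ZMod p) (FreeNilp p c)) :
    Submodule (ZMod p) (FreeNilp p c) :=
  V.map (phi p c 0) ⊔ V.map (phi p c 1)

/-- `Λ_{k+1} = φ₁(L_k) ∩ φ₂(L_k)`, indexed here by `k`. -/
def LambdaSucc (p c k : ℕ) : Submodule (ZMod p) (FreeNilp p c) :=
  collapse p c (layer p c k)

/-- `l_{k+1} = dim Λ_{k+1}`, indexed here by `k`. -/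
def lSucc (p c k : ℕ) : ℕ := Module.finrank (ZMod p) (LambdaSucc p c k)

/-- `f_k(m,i,p)`: the number of subspaces of `L_k` of dimension `m` and dimension of
collapse `i`. -/
def f (p c k m i : ℕ) : ℕ :=
  Set.ncard {V : Submodule (ZMod p) (FreeNilp p c) |
    V ≤ layer p c k ∧ Module.finrank (ZMod p) V = m ∧
      Module.finrank (ZMod p) (collapse p c V) = i}

/-- The number of subspaces `V` of `L_k` with `dim V = m` and `dim φ(V) = 2m - i`. -/
def fDefect (p c k m i : ℕ) : ℕ :=
  Set.ncard {V : Submodule (ZMod p) (FreeNilp p c) |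
    V ≤ layer p c k ∧ Module.finrank (ZMod p) V = m ∧
      Module.finrank (ZMod p) (phiSum p c V) + i = 2 * m}

/-- `I` is an `n`-step graded ideal starting at `k`: it is of the form
`I_k ⊕ ⋯ ⊕ I_{k+n} ⊕ L_{k+n+1} ⊕ ⋯ ⊕ L_c` with `I_j = I ∩ L_j`. -/
def IsStepGraded (p c n k : ℕ) (I : LieIdeal (ZMod p) (FreeNilp p c)) : Prop :=
  I.toSubmodule =
    (⨆ j ∈ Icc k (k + n), I.toSubmodule ⊓ layer p c j) ⊔
      ⨆ j ∈ Icc (k + n + 1) c, layer p c j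

/-- `dim I_j`, where `I_j = I ∩ L_j`. -/
def partDim (p c j : ℕ) (I : LieIdeal (ZMod p) (FreeNilp p c)) : ℕ :=
  Module.finrank (ZMod p) ↥(I.toSubmodule ⊓ layer p c j)

/-- `α₂(a,k,p)`. -/
def alpha2 (p c k a : ℕ) : ℕ :=
  Set.ncard {I : LieIdeal (ZMod p) (FreeNilp p c) |
    IsStepGraded p c 2 k I ∧
      partDim p c k I + partDim p c (k + 1) I + partDim p c (k + 2) I = a}

/-- The Gaussian binomial coefficient with arbitrary integer entries, equal to `1` if
`i = 0`, and to `0` if `i < 0` or `i > n` (and `i ≠ 0`). -/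
def gaussBinom (q : ℚ) (n i : ℤ) : ℚ :=
  if i = 0 then 1
  else if 0 < i ∧ i ≤ n then
    ∏ j ∈ range i.toNat, (1 - q ^ (n - (j : ℤ))) / (1 - q ^ (j + 1))
  else 0

/-- The inner sum: the number of ways to choose `I_{k+1}` and `I_{k+2}` once `dim I_k = m` and
`dim φ(I_k) = 2m - i`. -/
def innerSum (p c k a m i : ℕ) : ℚ :=
  ∑ m' ∈ Icc (2 * (m : ℤ) - i) (layerDim p c (k + 1) : ℤ),
    gaussBinom p (layerDim p c (k + 1) - (2 * m - i)) (m' - (2 * m - i)) *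
      gaussBinom p (layerDim p c (k + 2) - 2 * m') (a - m - m' - 2 * m')

end TwoStep

end

/-! A two-step graded ideal is the same as a chain V₀ ≤ L_k, φ(V₀) ≤ V₁ ≤ L_{k+1}, φ(V₁) ≤ V₂ ≤
L_{k+2}. For k = 1, 3, 5 one has d_{k+2} = 2 d_{k+1}, so (u, v) ↦ [X₁, u] + [X₂, v] is injective on
L_{k+1} × L_{k+1}. Hence Λ_{k+2} = 0 and dim φ(V₁) = 2 dim V₁. The number of choices of V₂ then
depends only on dimensions, and the number of choices of (V₁, V₂) depends on V₀ only through dim V₀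
and dim φ(V₀). Summing over V₀ gives the formula with `fDefect` (`alpha2_eq_sum_fDefect`). If φ₁ and
φ₂ are injective on L_k, which holds for k = 3, 5, the defect 2 dim V₀ - dim φ(V₀) is the dimension
of collapse, and the formula with `f` follows.

Polynomiality for k = 3, 5 rests on an explicit description of the kernel of L_k × L_k → L_{k+1}
(`IsPresentation`). It is {(A e, B e) : e ∈ E} with dim E = n (n = 1 for k = 3, n = 3 for k = 5),
and A, B together identify E ⊕ E with L_k. The defect of V becomes dim(A⁻¹V ∩ B⁻¹V). Double counting
the pairs (F, V) with AF + BF ≤ V and dim F = j gives unitriangular linear equations for the number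
of V of given dimension and defect (`sum_ncard_mul_gaussBinom`). Their coefficients are Gaussian
binomials, so the solutions are polynomials in p. For k = 1 every nonzero V ≤ L₁ has φ(V) = L₂, and
the count is direct.

The dimensions come from a squeeze (`isPresentation_of_relations`): explicit Lie relations in
weights 4 and 6 bound dimensions from above, while integral dual systems of word coefficients in the
free associative algebra bound d₃, d₅, d₇ from below in every characteristic. The condition p ≥ c
enters for k = 5, where 5 must be invertible. -/

noncomputable section

namespace TwoStep

open Finset TensorProduct

/-! ### Gaussian binomials count subspaces over a finite field. -/

section Counting

variable {K V : Type*} [Field K] [AddCommGroup V] [Module K V]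

theorem finrank_map_add_finrank_ker_inf {V' : Type*} [AddCommGroup V'] [Module K V']
    [FiniteDimensional K V] (g : V →ₗ[K] V') (W : Submodule K V) :
    Module.finrank K (W.map g) + Module.finrank K ↥(LinearMap.ker g ⊓ W) =
      Module.finrank K W := by
  have h := (g.domRestrict W).finrank_range_add_finrank_ker
  rw [LinearMap.range_domRestrict, LinearMap.ker_domRestrict] at h
  rw [← h, ← Submodule.finrank_map_subtype_eq W, Submodule.map_comap_subtype, inf_comm]

/-- Linearly independent families spanning a given subspace are its bases. -/
def spanFiberEquiv (k : ℕ) [FiniteDimensional K V] (W : {W : Submodule K V // Module.finrank K W = k}) :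
    {s : {s : Fin k → V // LinearIndependent K s} // Submodule.span K (Set.range s.1) = W.1} ≃
      {t : Fin k → W.1 // LinearIndependent K t} where
  toFun s := ⟨fun i => ⟨s.1.1 i, s.2.le (Submodule.subset_span ⟨i, rfl⟩)⟩,
    LinearIndependent.of_comp W.1.subtype s.1.2⟩
  invFun t := ⟨⟨fun i => t.1 i, t.2.map' W.1.subtype (Submodule.ker_subtype _)⟩, by
    have hli : LinearIndependent K (fun i => ((t.1 i : W.1) : V)) :=
      t.2.map' W.1.subtype (Submodule.ker_subtype _)
    refine Submodule.eq_of_le_of_finrank_eq ?_ ?_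
    · rw [Submodule.span_le]
      rintro _ ⟨i, rfl⟩
      exact (t.1 i).2
    · rw [finrank_span_eq_card hli, W.2, Fintype.card_fin]⟩
  left_inv s := rfl
  right_inv t := rfl

/-- Sort the linearly independent k-tuples of V by their span: each fibre is the set of ordered
bases of a k-dimensional space. -/
theorem card_subspaces_mul [Fintype K] [Finite V] {k : ℕ} (hk : k ≤ Module.finrank K V) :
    Nat.card {W : Submodule K V // Module.finrank K W = k} *
        ∏ i : Fin k, (Fintype.card K ^ k - Fintype.card K ^ (i : ℕ)) =
      ∏ i : Fin k, (Fintype.card K ^ Module.finrank K V - Fintype.card K ^ (i : ℕ)) := by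
  rw [← card_linearIndependent hk]
  let F : {s : Fin k → V // LinearIndependent K s} →
      {W : Submodule K V // Module.finrank K W = k} := fun s =>
    ⟨Submodule.span K (Set.range s.1), by rw [finrank_span_eq_card s.2, Fintype.card_fin]⟩
  have hfib : ∀ W, Nat.card {s // F s = W} =
      ∏ i : Fin k, (Fintype.card K ^ k - Fintype.card K ^ (i : ℕ)) := by
    intro W
    have h := card_linearIndependent (K := K) (V := W.1) (k := k) W.2.ge
    rw [W.2] at h
    rw [← h]
    refine Nat.card_congr (Equiv.trans (Equiv.subtypeEquivRight fun s => ?_) (spanFiberEquiv k W))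
    exact Subtype.ext_iff
  have : Finite (Submodule K V) := Finite.of_injective _ SetLike.coe_injective
  have : Fintype {W : Submodule K V // Module.finrank K W = k} := Fintype.ofFinite _
  rw [← Nat.card_congr (Equiv.sigmaFiberEquiv F), Nat.card_sigma]
  rw [Finset.sum_congr rfl (fun W _ => hfib W), Finset.sum_const, Finset.card_univ,
    Nat.card_eq_fintype_card, smul_eq_mul]

theorem gaussBinom_natCast {q : ℚ} (n k : ℕ) :
    gaussBinom q n k = ∏ j ∈ range k, (1 - q ^ ((n : ℤ) - j)) / (1 - q ^ (j + 1)) := by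
  unfold gaussBinom
  split_ifs with h0 h1
  · have : k = 0 := by exact_mod_cast h0
    subst this; simp
  · simp
  · have hk : n < k := by omega
    symm
    -- For k > n the factor with j = n is 1 - q ^ 0 = 0, so the product formula also covers the
    -- default value.
    refine Finset.prod_eq_zero (Finset.mem_range.2 hk) ?_
    simp

theorem gaussBinom_natCast_eq_prod {q : ℚ} (hq : 1 < q) (n k : ℕ) :
    gaussBinom q n k * ∏ i : Fin k, (q ^ k - q ^ (i : ℕ)) = ∏ i : Fin k, (q ^ n - q ^ (i : ℕ)) := by
  rw [gaussBinom_natCast, Fin.prod_univ_eq_prod_range (fun i => q ^ k - q ^ i),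
    Fin.prod_univ_eq_prod_range (fun i => q ^ n - q ^ i), Finset.prod_div_distrib]
  have hq0 : q ≠ 0 := by positivity
  have h1 : ∏ i ∈ range k, (q ^ k - q ^ i) =
      (∏ i ∈ range k, q ^ i) * ∏ i ∈ range k, -(1 - q ^ (i + 1)) := by
    rw [← Finset.prod_range_reflect (fun i => -(1 - q ^ (i + 1))), ← Finset.prod_mul_distrib]
    refine Finset.prod_congr rfl fun i hi => ?_
    have hi := Finset.mem_range.1 hi
    have : k = i + (k - 1 - i + 1) := by omega
    conv_lhs => rw [this, pow_add]
    ring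
  have h2 : ∏ i ∈ range k, (q ^ n - q ^ i) =
      (∏ i ∈ range k, q ^ i) * ∏ i ∈ range k, -(1 - q ^ ((n : ℤ) - i)) := by
    rw [← Finset.prod_mul_distrib]
    refine Finset.prod_congr rfl fun i hi => ?_
    have hi := Finset.mem_range.1 hi
    rw [zpow_sub₀ hq0, zpow_natCast, zpow_natCast]
    field_simp
    ring
  have h3 : ∏ j ∈ range k, (1 - q ^ (j + 1)) ≠ 0 := by
    refine Finset.prod_ne_zero_iff.2 fun i _ => ?_
    have : 1 < q ^ (i + 1) := one_lt_pow₀ hq (by omega)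
    linarith
  rw [h1, h2, Finset.prod_neg, Finset.prod_neg]
  field_simp

theorem ncard_subspaces [Fintype K] [Finite V] (k : ℕ) :
    (Set.ncard {W : Submodule K V | Module.finrank K W = k} : ℚ) =
      gaussBinom (Fintype.card K) (Module.finrank K V) k := by
  have hq : (1 : ℚ) < Fintype.card K := by exact_mod_cast Fintype.one_lt_card
  rcases le_or_gt k (Module.finrank K V) with hk | hk
  · have h := card_subspaces_mul (K := K) hk
    have h' := gaussBinom_natCast_eq_prod hq (Module.finrank K V) k
    have hc : ∀ n, k ≤ n → ((∏ i : Fin k, (Fintype.card K ^ n - Fintype.card K ^ (i : ℕ)) : ℕ) : ℚ)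
        = ∏ i : Fin k, ((Fintype.card K : ℚ) ^ n - (Fintype.card K : ℚ) ^ (i : ℕ)) := by
      intro n hn
      push_cast
      refine Finset.prod_congr rfl fun i _ => ?_
      rw [Nat.cast_sub (Nat.pow_le_pow_right Fintype.card_pos (i.2.le.trans hn))]
      push_cast; rfl
    have h2 := congrArg (Nat.cast : ℕ → ℚ) h
    rw [Nat.cast_mul, hc k le_rfl, hc _ hk, ← h'] at h2
    refine mul_right_cancel₀ (Finset.prod_ne_zero_iff.2 fun i _ => ?_) h2
    have := pow_lt_pow_right₀ hq i.2
    linarith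
  · have : {W : Submodule K V | Module.finrank K W = k} = ∅ := by
      ext W
      simp only [Set.mem_ofPred_eq, Set.mem_empty_iff_false, iff_false]
      have := Submodule.finrank_le W
      omega
    rw [this, Set.ncard_empty, gaussBinom, if_neg (by omega), if_neg (by omega)]
    simp

theorem ncard_subspaces_le [Fintype K] [Finite V] (W : Submodule K V) (k : ℕ) :
    (Set.ncard {U : Submodule K V | U ≤ W ∧ Module.finrank K U = k} : ℚ) =
      gaussBinom (Fintype.card K) (Module.finrank K W) k := by
  rw [← ncard_subspaces (V := W), ← Set.ncard_image_of_injective _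
    (Submodule.map_injective_of_injective (f := W.subtype) W.injective_subtype)]
  congr 2
  ext U
  simp only [Set.mem_ofPred_eq, Set.mem_image]
  constructor
  · rintro ⟨h, hk⟩
    have hU : (U.comap W.subtype).map W.subtype = U := by
      rw [Submodule.map_comap_subtype, inf_eq_right.2 h]
    exact ⟨U.comap W.subtype, by rw [← Submodule.finrank_map_subtype_eq, hU, hk], hU⟩
  · rintro ⟨U, rfl, rfl⟩
    exact ⟨Submodule.map_subtype_le _ _, Submodule.finrank_map_subtype_eq _ _⟩

/-- Passing to the quotient by U reduces this to subspaces of W/U. For m < dim U both sides vanish,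
the lower index of the binomial being negative. -/
theorem ncard_subspaces_between [Fintype K] [Finite V] {U W : Submodule K V} (h : U ≤ W) (m : ℕ) :
    (Set.ncard {X : Submodule K V | U ≤ X ∧ X ≤ W ∧ Module.finrank K X = m} : ℚ) =
      gaussBinom (Fintype.card K) (Module.finrank K W - Module.finrank K U)
        (m - Module.finrank K U) := by
  have hdim : ∀ X : Submodule K V, U ≤ X →
      Module.finrank K (X.map U.mkQ) + Module.finrank K U = Module.finrank K X := by
    intro X hX
    rw [← finrank_map_add_finrank_ker_inf U.mkQ X, Submodule.ker_mkQ, inf_eq_left.2 hX]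
  have : Finite (V ⧸ U) := Finite.of_surjective _ U.mkQ_surjective
  rcases le_or_gt (Module.finrank K U) m with hm | hm
  · rw [← hdim W h]
    push_cast
    rw [add_sub_cancel_right, ← Nat.cast_sub hm, ← ncard_subspaces_le (W.map U.mkQ),
      ← Set.ncard_image_of_injective _
        (Submodule.comap_injective_of_surjective U.mkQ_surjective)]
    congr 2
    ext X
    simp only [Set.mem_ofPred_eq, Set.mem_image]
    constructor
    · rintro ⟨hUX, hXW, hX⟩
      refine ⟨X.map U.mkQ, ⟨Submodule.map_mono hXW, ?_⟩, ?_⟩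
      · have := hdim X hUX
        omega
      · rw [Submodule.comap_map_mkQ, sup_eq_right.2 hUX]
    · rintro ⟨Y, ⟨hYW, hY⟩, rfl⟩
      have hU : U ≤ Y.comap U.mkQ := by
        conv_lhs => rw [← U.ker_mkQ]
        exact LinearMap.ker_le_comap _
      refine ⟨hU, ?_, ?_⟩
      · refine (Submodule.comap_mono hYW).trans ?_
        rw [Submodule.comap_map_mkQ, sup_eq_right.2 h]
      · rw [← hdim _ hU, Submodule.map_comap_eq_of_surjective U.mkQ_surjective, hY]
        omega
  · have : {X : Submodule K V | U ≤ X ∧ X ≤ W ∧ Module.finrank K X = m} = ∅ := by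
      ext X
      simp only [Set.mem_ofPred_eq, Set.mem_empty_iff_false, iff_false]
      rintro ⟨h1, -, h2⟩
      have := Submodule.finrank_mono h1
      omega
    rw [this, Set.ncard_empty, gaussBinom, if_neg (by omega), if_neg (by omega)]
    simp

end Counting

/-! ### The q-Pascal rule and polynomiality of Gaussian binomials. -/

theorem gaussBinom_natCast_succ_succ {q : ℚ} (hq : 1 < q) (n k : ℕ) :
    gaussBinom q (n + 1 : ℕ) (k + 1 : ℕ) =
      gaussBinom q n k + q ^ (k + 1) * gaussBinom q n (k + 1 : ℕ) := by
  have hq0 : q ≠ 0 := by positivity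
  have hne : ∀ j : ℕ, 1 - q ^ (j + 1) ≠ 0 := fun j => by
    have : 1 < q ^ (j + 1) := one_lt_pow₀ hq (by omega)
    linarith
  have h1 : gaussBinom q (n + 1 : ℕ) (k + 1 : ℕ) =
      gaussBinom q n k * ((1 - q ^ (n + 1)) / (1 - q ^ (k + 1))) := by
    rw [gaussBinom_natCast, gaussBinom_natCast, Finset.prod_div_distrib, Finset.prod_div_distrib,
      Finset.prod_range_succ', Finset.prod_range_succ (fun x => 1 - q ^ (x + 1))]
    have : ∀ x : ℕ, (((n + 1 : ℕ) : ℤ) - ((x + 1 : ℕ) : ℤ)) = n - x := fun x => by push_cast; ring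
    simp only [this]
    rw [mul_div_mul_comm]
    congr 2
  have h2 : gaussBinom q n (k + 1 : ℕ) =
      gaussBinom q n k * ((1 - q ^ ((n : ℤ) - k)) / (1 - q ^ (k + 1))) := by
    rw [gaussBinom_natCast, gaussBinom_natCast, Finset.prod_range_succ]
  rw [h1, h2, zpow_sub₀ hq0, zpow_natCast, zpow_natCast]
  have := hne k
  field_simp
  ring

theorem gaussBinom_natCast_polynomial (n k : ℕ) :
    ∃ P : Polynomial ℚ, ∀ q : ℕ, 2 ≤ q → gaussBinom q n k = P.eval (q : ℚ) := by
  induction n generalizing k with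
  | zero =>
    rcases k with _ | k
    · exact ⟨1, fun q _ => by simp [gaussBinom]⟩
    · exact ⟨0, fun q _ => by
        rw [gaussBinom, if_neg (by omega), if_neg (by omega), Polynomial.eval_zero]⟩
  | succ n ih =>
    rcases k with _ | k
    · exact ⟨1, fun q _ => by simp [gaussBinom]⟩
    · obtain ⟨P, hP⟩ := ih k
      obtain ⟨Q, hQ⟩ := ih (k + 1)
      refine ⟨P + Polynomial.X ^ (k + 1) * Q, fun q hq => ?_⟩
      rw [gaussBinom_natCast_succ_succ (by exact_mod_cast hq), hP q hq, hQ q hq]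
      simp

theorem gaussBinom_polynomial (n i : ℤ) :
    ∃ P : Polynomial ℚ, ∀ q : ℕ, 2 ≤ q → gaussBinom q n i = P.eval (q : ℚ) := by
  by_cases h : 0 < i ∧ i ≤ n
  · lift i to ℕ using h.1.le
    lift n to ℕ using by omega
    exact gaussBinom_natCast_polynomial n i
  · by_cases h0 : i = 0
    · exact ⟨1, fun q _ => by simp [gaussBinom, h0]⟩
    · exact ⟨0, fun q _ => by simp [gaussBinom, h0, h]⟩

/-! ### Counting subspaces by defect for a pair of maps E → L. -/

section Kronecker

variable {K E L : Type*} [Field K] [AddCommGroup E] [Module K E] [AddCommGroup L] [Module K L]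

theorem ncard_setOf_eq_card_filter {α : Type*} [Fintype α] (P : α → Prop) [DecidablePred P] :
    Set.ncard {x | P x} = #{x | P x} := by
  rw [Set.ncard_eq_toFinset_card']
  congr 1
  ext; simp

theorem map_sup_map_le_iff (A B : E →ₗ[K] L) (F : Submodule K E) (V : Submodule K L) :
    F.map A ⊔ F.map B ≤ V ↔ F ≤ V.comap A ⊓ V.comap B := by
  rw [sup_le_iff, le_inf_iff, Submodule.map_le_iff_le_comap, Submodule.map_le_iff_le_comap]

theorem finrank_prod_submodule [FiniteDimensional K E] [FiniteDimensional K L]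
    (F : Submodule K E) (G : Submodule K L) :
    Module.finrank K (F.prod G) = Module.finrank K F + Module.finrank K G := by
  rw [← Module.finrank_prod]
  exact LinearEquiv.finrank_eq
    { toFun := fun x => (⟨x.1.1, x.2.1⟩, ⟨x.1.2, x.2.2⟩)
      invFun := fun y => ⟨(y.1, y.2), y.1.2, y.2.2⟩
      map_add' := fun _ _ => rfl
      map_smul' := fun _ _ => rfl
      left_inv := fun _ => rfl
      right_inv := fun _ => rfl }

/-- Count pairs (F, V) with dim F = j, dim V = m and AF + BF ≤ V ≤ W in two ways. For fixed V, F
ranges over subspaces of A⁻¹V ∩ B⁻¹V. For fixed F, V lies between AF + BF, of dimension 2j by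
injectivity, and W, of dimension 2 dim E. -/
theorem sum_ncard_mul_gaussBinom [Fintype K] [Finite E] [Finite L] {A B : E →ₗ[K] L}
    (hAB : Function.Injective (A.coprod B)) {W : Submodule K L}
    (hW : (⊤ : Submodule K E).map A ⊔ (⊤ : Submodule K E).map B = W) (m j : ℕ) :
    ∑ i ∈ range (Module.finrank K E + 1),
        (Set.ncard {V : Submodule K L | V ≤ W ∧ Module.finrank K V = m ∧
          Module.finrank K ↥(V.comap A ⊓ V.comap B) = i} : ℚ) * gaussBinom (Fintype.card K) i j =
      gaussBinom (Fintype.card K) (Module.finrank K E) j *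
        gaussBinom (Fintype.card K) (2 * Module.finrank K E - 2 * j) (m - 2 * j) := by
  classical
  have : Finite (Submodule K L) := Finite.of_injective _ SetLike.coe_injective
  have : Finite (Submodule K E) := Finite.of_injective _ SetLike.coe_injective
  have : Fintype (Submodule K L) := Fintype.ofFinite _
  have : Fintype (Submodule K E) := Fintype.ofFinite _
  have hS : ∀ F : Submodule K E, Module.finrank K ↥(F.map A ⊔ F.map B) = 2 * Module.finrank K F := by
    intro F
    rw [← LinearMap.map_coprod_prod,
      ← (Submodule.equivMapOfInjective (A.coprod B) hAB _).finrank_eq,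
      finrank_prod_submodule, two_mul]
  have hWdim : Module.finrank K W = 2 * Module.finrank K E := by
    rw [← hW, hS, finrank_top]
  let s : Finset (Submodule K L) := {V | V ≤ W ∧ Module.finrank K V = m}
  let t : Finset (Submodule K E) := {F | Module.finrank K F = j}
  have key := Finset.sum_card_bipartiteAbove_eq_sum_card_bipartiteBelow (s := s) (t := t)
    (fun V F => F ≤ V.comap A ⊓ V.comap B)
  have hleft : ∀ V ∈ s, (#(t.bipartiteAbove (fun V F => F ≤ V.comap A ⊓ V.comap B) V) : ℚ) =
      gaussBinom (Fintype.card K) (Module.finrank K ↥(V.comap A ⊓ V.comap B)) j := by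
    intro V _
    rw [← ncard_subspaces_le, ncard_setOf_eq_card_filter]
    congr 2
    ext F
    simp [t, Finset.bipartiteAbove, and_comm]
  have hright : ∀ F ∈ t, (#(s.bipartiteBelow (fun V F => F ≤ V.comap A ⊓ V.comap B) F) : ℚ) =
      gaussBinom (Fintype.card K) (2 * Module.finrank K E - 2 * j) (m - 2 * j) := by
    intro F hF
    have hF : Module.finrank K F = j := by simpa [t] using hF
    have hFW : F.map A ⊔ F.map B ≤ W := by
      rw [← hW]; exact sup_le_sup (Submodule.map_mono le_top) (Submodule.map_mono le_top)
    have h := ncard_subspaces_between hFW m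
    rw [hWdim, hS, hF] at h
    push_cast at h
    rw [← h, ncard_setOf_eq_card_filter]
    congr 2
    ext V
    simp only [s, Finset.bipartiteBelow, Finset.mem_filter, Finset.mem_univ, true_and,
      map_sup_map_le_iff]
    tauto
  have key' := congrArg (Nat.cast : ℕ → ℚ) key
  rw [Nat.cast_sum, Nat.cast_sum, Finset.sum_congr rfl hleft, Finset.sum_congr rfl hright,
    Finset.sum_const, nsmul_eq_mul] at key'
  rw [← ncard_subspaces, ncard_setOf_eq_card_filter, ← key']
  rw [← Finset.sum_fiberwise_of_maps_to (t := range (Module.finrank K E + 1))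
    (g := fun V : Submodule K L => Module.finrank K ↥(V.comap A ⊓ V.comap B))
    (fun V _ => Finset.mem_range.2 (Nat.lt_succ_of_le (Submodule.finrank_le _)))]
  refine Finset.sum_congr rfl fun i _ => ?_
  have : ∀ V ∈ s.filter (fun V : Submodule K L => Module.finrank K ↥(V.comap A ⊓ V.comap B) = i),
      gaussBinom (Fintype.card K) (Module.finrank K ↥(V.comap A ⊓ V.comap B)) j =
      gaussBinom (Fintype.card K) i j := by
    intro V hV
    rw [(Finset.mem_filter.1 hV).2]
  rw [Finset.sum_congr rfl this, Finset.sum_const, nsmul_eq_mul, ncard_setOf_eq_card_filter]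
  congr 3
  ext V
  simp [s, and_assoc]

end Kronecker

/-- A system of linear equations whose matrix `gaussBinom q i j` is unitriangular has solutions
that are polynomial in `q` when its right-hand sides are. -/
theorem polynomial_of_sum_mul_gaussBinom (n : ℕ) (R : ℕ → ℕ → ℚ)
    (hR : ∀ j, ∃ P : Polynomial ℚ, ∀ q : ℕ, 2 ≤ q → R q j = P.eval (q : ℚ)) (i : ℕ) (hi : i ≤ n) :
    ∃ P : Polynomial ℚ, ∀ (q : ℕ) (h : ℕ → ℚ), 2 ≤ q →
      (∀ j ≤ n, ∑ i ∈ range (n + 1), h i * gaussBinom q i j = R q j) → h i = P.eval (q : ℚ) := by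
  induction hd : n - i using Nat.strong_induction_on generalizing i with
  | _ d ih =>
    -- Back substitution: the unknowns of index above i are already solved. Indices outside (i, n]
    -- get a dummy polynomial so that a choice exists for every i'.
    have ih' : ∀ i', ∃ P : Polynomial ℚ, i < i' → i' ≤ n → ∀ (q : ℕ) (h : ℕ → ℚ), 2 ≤ q →
        (∀ j ≤ n, ∑ i ∈ range (n + 1), h i * gaussBinom q i j = R q j) →
          h i' = P.eval (q : ℚ) := by
      intro i'
      by_cases h : i < i' ∧ i' ≤ n
      · obtain ⟨P, hP⟩ := ih (n - i') (by omega) i' h.2 rfl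
        exact ⟨P, fun _ _ => hP⟩
      · exact ⟨0, fun h1 h2 => absurd ⟨h1, h2⟩ h⟩
    choose Q hQ using ih'
    choose G hG using fun i' : ℕ => gaussBinom_polynomial i' i
    obtain ⟨T, hT⟩ := hR i
    refine ⟨T - ∑ i' ∈ Ioc i n, Q i' * G i', fun q h hq hh => ?_⟩
    have h1 := hh i hi
    -- In equation i the terms below i vanish, and the diagonal coefficient is 1.
    have hsplit : ∑ i' ∈ range (n + 1), h i' * gaussBinom q i' i =
        h i + ∑ i' ∈ Ioc i n, h i' * gaussBinom q i' i := by
      have hsub : Icc i n ⊆ range (n + 1) := fun x hx => by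
        rw [Finset.mem_Icc] at hx; rw [Finset.mem_range]; omega
      rw [← Finset.sum_subset hsub, ← Finset.sum_Ioc_add_eq_sum_Icc hi, add_comm]
      · congr 1
        rw [gaussBinom_natCast]
        have : ∏ j ∈ range i, (1 - (q : ℚ) ^ ((i : ℤ) - j)) / (1 - (q : ℚ) ^ (j + 1)) = 1 := by
          rw [Finset.prod_div_distrib, ← Finset.prod_range_reflect]
          rw [div_eq_one_iff_eq]
          · refine Finset.prod_congr rfl fun j hj => ?_
            have hj := Finset.mem_range.1 hj
            rw [show ((i : ℤ) - ((i - 1 - j : ℕ) : ℤ)) = ((j + 1 : ℕ) : ℤ) by omega, zpow_natCast]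
          · refine Finset.prod_ne_zero_iff.2 fun j _ => ?_
            have : (1 : ℚ) < (q : ℚ) ^ (j + 1) := one_lt_pow₀ (by exact_mod_cast hq) (by omega)
            linarith
        rw [this, mul_one]
      · intro x hx hx'
        rw [Finset.mem_range] at hx
        rw [Finset.mem_Icc] at hx'
        rw [gaussBinom, if_neg (by omega), if_neg (by omega), mul_zero]
    rw [hsplit, hT q hq] at h1
    rw [Polynomial.eval_sub, ← h1, Polynomial.eval_finsetSum, eq_sub_iff_add_eq, add_right_inj]
    refine Finset.sum_congr rfl fun i' hi' => ?_
    rw [Finset.mem_Ioc] at hi'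
    rw [Polynomial.eval_mul, hQ i' hi'.1 hi'.2 q h hq hh, hG i' q hq]

/-! ### Right-normed brackets span each weight. -/

section RightNormed

variable {R L L' : Type*} [CommRing R] [LieRing L] [LieAlgebra R L] [LieRing L'] [LieAlgebra R L']

/-- The span of the right-normed brackets of weight `n + 1` in `x 0` and `x 1`. -/
def rightNormed (R : Type*) {L : Type*} [CommRing R] [LieRing L] [LieAlgebra R L] (x : Fin 2 → L) :
    ℕ → Submodule R L
  | 0 => Submodule.span R (Set.range x)
  | n + 1 => (rightNormed R x n).map (LieAlgebra.ad R L (x 0) : Module.End R L) ⊔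
      (rightNormed R x n).map (LieAlgebra.ad R L (x 1) : Module.End R L)

theorem lie_mem_rightNormed_succ (x : Fin 2 → L) {n : ℕ} {u : L} (hu : u ∈ rightNormed R x n)
    (i : Fin 2) : ⁅x i, u⁆ ∈ rightNormed R x (n + 1) := by
  fin_cases i
  · exact Submodule.mem_sup_left ⟨u, hu, rfl⟩
  · exact Submodule.mem_sup_right ⟨u, hu, rfl⟩

theorem rightNormed_succ_le (x : Fin 2 → L) {n : ℕ} {S : Submodule R L}
    (h : ∀ i, ∀ u ∈ rightNormed R x n, ⁅x i, u⁆ ∈ S) : rightNormed R x (n + 1) ≤ S := by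
  refine sup_le ?_ ?_ <;> rintro _ ⟨u, hu, rfl⟩ <;> exact h _ u hu

/-- Jacobi rewrites [[x, w], v] as [x, [w, v]] - [w, [x, v]], which lowers the weight of the left
entry. Index n stands for weight n + 1, whence the extra 1. -/
theorem lie_mem_rightNormed (x : Fin 2 → L) {m n : ℕ} {u v : L} (hu : u ∈ rightNormed R x m)
    (hv : v ∈ rightNormed R x n) : ⁅u, v⁆ ∈ rightNormed R x (m + n + 1) := by
  induction m generalizing u v n with
  | zero =>
    have : Submodule.span R (Set.range x) ≤ (rightNormed R x (0 + n + 1)).comap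
        ((LieAlgebra.ad R L : L →ₗ[R] Module.End R L).flip v) := by
      rw [Submodule.span_le]
      rintro _ ⟨i, rfl⟩
      rw [zero_add]
      exact lie_mem_rightNormed_succ x hv i
    exact this hu
  | succ m ih =>
    have : rightNormed R x (m + 1) ≤ (rightNormed R x (m + 1 + n + 1)).comap
        ((LieAlgebra.ad R L : L →ₗ[R] Module.End R L).flip v) := by
      refine rightNormed_succ_le x fun i w (hw : w ∈ rightNormed R x m) => ?_
      change ⁅⁅x i, w⁆, v⁆ ∈ rightNormed R x (m + 1 + n + 1)
      rw [lie_lie]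
      refine sub_mem ?_ ?_
      · rw [show m + 1 + n + 1 = (m + n + 1) + 1 by ring]
        exact lie_mem_rightNormed_succ x (ih hw hv) i
      · rw [show m + 1 + n + 1 = m + (n + 1) + 1 by ring]
        exact ih hw (lie_mem_rightNormed_succ x hv i)
    exact this hu

theorem map_rightNormed (g : L →ₗ⁅R⁆ L') (x : Fin 2 → L) (n : ℕ) :
    (rightNormed R x n).map (g : L →ₗ[R] L') = rightNormed R (g ∘ x) n := by
  induction n with
  | zero => simp [rightNormed, Submodule.map_span, Set.range_comp]
  | succ n ih =>
    simp only [rightNormed, Submodule.map_sup, ← ih, ← Submodule.map_comp]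
    congr 2 <;> ext u <;> simp

theorem lowerCentralSeries_le_iSup_rightNormed {x : Fin 2 → L}
    (hx : ⨆ n, rightNormed R x n = ⊤) (c : ℕ) :
    (LieModule.lowerCentralSeries R L L c).toSubmodule ≤ ⨆ n, rightNormed R x (c + n) := by
  induction c with
  | zero => simp [hx]
  | succ c ih =>
    rw [LieModule.lowerCentralSeries_succ, LieSubmodule.lieIdeal_oper_eq_linear_span',
      Submodule.span_le]
    rintro _ ⟨u, -, v, hv, rfl⟩
    have hu : u ∈ ⨆ n, rightNormed R x n := hx ▸ Submodule.mem_top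
    replace hv := ih hv
    clear ih
    induction hu using Submodule.iSup_induction' with
    | mem m u hu =>
      induction hv using Submodule.iSup_induction' with
      | mem n v hv =>
        have := lie_mem_rightNormed x hu hv
        rw [show m + (c + n) + 1 = c + 1 + (m + n) by ring] at this
        exact Submodule.mem_iSup_of_mem _ this
      | zero => simp
      | add a b _ _ ha hb => rw [lie_add]; exact add_mem ha hb
    | zero => simp
    | add a b _ _ ha hb => rw [add_lie]; exact add_mem ha hb

end RightNormed

/-- The sum is a subalgebra S containing the generators. The lift of the generators to S, followed
by the inclusion, is the identity by the universal property. -/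
theorem iSup_rightNormed_freeLieAlgebra (R : Type*) [CommRing R] :
    ⨆ n, rightNormed R (FreeLieAlgebra.of R : Fin 2 → FreeLieAlgebra R (Fin 2)) n = ⊤ := by
  let x := (FreeLieAlgebra.of R : Fin 2 → FreeLieAlgebra R (Fin 2))
  let S : LieSubalgebra R (FreeLieAlgebra R (Fin 2)) :=
    { (⨆ n, rightNormed R x n) with
      lie_mem' := by
        intro u v hu hv
        change u ∈ ⨆ n, rightNormed R x n at hu
        change v ∈ ⨆ n, rightNormed R x n at hv
        change ⁅u, v⁆ ∈ ⨆ n, rightNormed R x n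
        induction hu using Submodule.iSup_induction' with
        | mem m u hu =>
          induction hv using Submodule.iSup_induction' with
          | mem n v hv => exact Submodule.mem_iSup_of_mem _ (lie_mem_rightNormed x hu hv)
          | zero => simp
          | add a b _ _ ha hb => rw [lie_add]; exact add_mem ha hb
        | zero => simp
        | add a b _ _ ha hb => rw [add_lie]; exact add_mem ha hb }
  let g : FreeLieAlgebra R (Fin 2) →ₗ⁅R⁆ S := FreeLieAlgebra.lift R fun i =>
    ⟨x i, Submodule.mem_iSup_of_mem (p := rightNormed R x) 0 (Submodule.subset_span ⟨i, rfl⟩)⟩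
  have hg : S.incl.comp g = LieHom.id := by
    ext i
    simp [g, x]
  rw [eq_top_iff]
  intro u _
  have : S.incl (g u) = u := by rw [← LieHom.comp_apply, hg]; rfl
  rw [← this]
  exact (g u).2

/-! ### The weight grading of the free nilpotent Lie algebra. -/

section Layers

variable (p c : ℕ)

/-- The quotient map from the free Lie algebra to its nilpotent quotient. -/
def toFreeNilp : FreeLieAlgebra (ZMod p) (Fin 2) →ₗ⁅ZMod p⁆ FreeNilp p c where
  toFun u := LieSubmodule.Quotient.mk u
  map_add' _ _ := rfl
  map_smul' _ _ := rfl
  map_lie' := rfl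

theorem toFreeNilp_surjective : Function.Surjective (toFreeNilp p c) := Quot.mk_surjective

theorem toFreeNilp_comp_of : toFreeNilp p c ∘ FreeLieAlgebra.of (ZMod p) = gen p c := rfl

theorem toFreeNilp_of (i : Fin 2) :
    toFreeNilp p c (FreeLieAlgebra.of (ZMod p) i) = gen p c i := rfl

theorem toFreeNilp_eq_zero_iff {u : FreeLieAlgebra (ZMod p) (Fin 2)} :
    toFreeNilp p c u = 0 ↔ u ∈ LieModule.lowerCentralSeries (ZMod p)
      (FreeLieAlgebra (ZMod p) (Fin 2)) (FreeLieAlgebra (ZMod p) (Fin 2)) c :=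
  LieSubmodule.Quotient.mk_eq_zero'

theorem layer_zero : layer p c 0 = ⊥ := by
  rw [layer, Submodule.span_eq_bot]
  have : ∀ k u, IsMonomial p c k u → 1 ≤ k := by
    intro k u h
    induction h <;> omega
  intro u hu
  exact absurd (this 0 u hu) (by norm_num)

/-- Arbitrary bracketings reduce to right-normed ones. This yields the recursion L_{k+1} = φ(L_k)
for k ≥ 1. -/
theorem layer_succ (n : ℕ) : layer p c (n + 1) = rightNormed (ZMod p) (gen p c) n := by
  apply le_antisymm
  · rw [layer, Submodule.span_le]
    have : ∀ k u, IsMonomial p c k u → ∃ n, k = n + 1 ∧ u ∈ rightNormed (ZMod p) (gen p c) n := by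
      intro k u h
      induction h with
      | gen i => exact ⟨0, rfl, Submodule.subset_span ⟨i, rfl⟩⟩
      | bracket _ _ h1 h2 =>
        obtain ⟨m, rfl, hm⟩ := h1
        obtain ⟨n, rfl, hn⟩ := h2
        exact ⟨m + n + 1, by ring, lie_mem_rightNormed _ hm hn⟩
    intro u hu
    obtain ⟨m, hm, h⟩ := this _ u hu
    rwa [← Nat.succ_injective hm] at h
  · induction n with
    | zero =>
      rw [rightNormed, Submodule.span_le]
      rintro _ ⟨i, rfl⟩
      exact Submodule.subset_span (IsMonomial.gen i)
    | succ n ih =>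
      refine rightNormed_succ_le _ fun i u hu => ?_
      have hu := ih hu
      have : layer p c (n + 1) ≤ (layer p c (n + 1 + 1)).comap
          (LieAlgebra.ad (ZMod p) (FreeNilp p c) (gen p c i) : Module.End _ _) := by
        rw [layer, Submodule.span_le]
        intro v hv
        refine Submodule.subset_span ?_
        rw [add_comm (n + 1)]
        exact IsMonomial.bracket (IsMonomial.gen i) hv
      exact this hu

theorem layer_add_two (n : ℕ) : layer p c (n + 2) = phiSum p c (layer p c (n + 1)) := by
  rw [layer_succ, layer_succ]
  rfl

theorem rightNormed_le_lowerCentralSeries (n : ℕ) :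
    rightNormed (ZMod p) (FreeLieAlgebra.of (ZMod p)) n ≤
      (LieModule.lowerCentralSeries (ZMod p) (FreeLieAlgebra (ZMod p) (Fin 2))
        (FreeLieAlgebra (ZMod p) (Fin 2)) n).toSubmodule := by
  induction n with
  | zero => simp
  | succ n ih =>
    refine rightNormed_succ_le _ fun i u hu => ?_
    rw [LieModule.lowerCentralSeries_succ]
    exact LieSubmodule.lie_mem_lie (LieSubmodule.mem_top _) (ih hu)

theorem map_toFreeNilp_rightNormed (n : ℕ) :
    (rightNormed (ZMod p) (FreeLieAlgebra.of (ZMod p)) n).map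
      (toFreeNilp p c : FreeLieAlgebra (ZMod p) (Fin 2) →ₗ[ZMod p] FreeNilp p c) =
    layer p c (n + 1) := by
  rw [map_rightNormed, toFreeNilp_comp_of, layer_succ]

theorem layer_eq_bot {k : ℕ} (h : c < k) : layer p c k = ⊥ := by
  obtain ⟨n, rfl⟩ := Nat.exists_eq_add_of_lt h
  rw [← map_toFreeNilp_rightNormed, eq_bot_iff]
  rintro _ ⟨u, hu, rfl⟩
  exact (toFreeNilp_eq_zero_iff p c).2
    (LieModule.antitone_lowerCentralSeries _ _ _ (Nat.le_add_right c n)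
      (rightNormed_le_lowerCentralSeries p _ hu))

theorem iSup_layer_succ : ⨆ n, layer p c (n + 1) = ⊤ := by
  simp_rw [← map_toFreeNilp_rightNormed, ← Submodule.map_iSup, iSup_rightNormed_freeLieAlgebra,
    Submodule.map_top]
  exact LinearMap.range_eq_top.2 (toFreeNilp_surjective p c)

theorem iSup_layer : ⨆ j ∈ Icc 1 c, layer p c j = ⊤ := by
  rw [eq_top_iff, ← iSup_layer_succ]
  refine iSup_le fun n => ?_
  by_cases h : n + 1 ≤ c
  · exact le_iSup₂_of_le (n + 1) (by simp [h]) le_rfl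
  · rw [layer_eq_bot p c (by omega)]
    exact bot_le

instance layer_finite (k : ℕ) : Module.Finite (ZMod p) (layer p c k) := by
  rw [Module.Finite.iff_fg]
  rcases k with _ | n
  · rw [layer_zero]; exact Submodule.fg_bot
  · rw [layer_succ]
    induction n with
    | zero => exact Submodule.fg_span (Set.finite_range _)
    | succ n ih => exact (ih.map _).sup (ih.map _)

instance freeNilp_finite : Module.Finite (ZMod p) (FreeNilp p c) := by
  rw [Module.finite_def, ← iSup_layer]
  exact Submodule.fg_biSup _ _ fun j _ => Module.Finite.iff_fg.1 (layer_finite p c j)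

/-- The homomorphism multiplying the component of weight `n` by `t ^ n`. -/
def weightHom : FreeLieAlgebra (ZMod p) (Fin 2) →ₗ⁅ZMod p⁆
    (Polynomial (ZMod p) ⊗[ZMod p] FreeNilp p c) :=
  FreeLieAlgebra.lift (ZMod p) fun i => Polynomial.X ⊗ₜ gen p c i

theorem weightHom_of_mem {n : ℕ} {u : FreeLieAlgebra (ZMod p) (Fin 2)}
    (hu : u ∈ rightNormed (ZMod p) (FreeLieAlgebra.of (ZMod p)) n) :
    weightHom p c u = (Polynomial.X ^ (n + 1) : Polynomial (ZMod p)) ⊗ₜ toFreeNilp p c u := by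
  let T : ℕ → FreeLieAlgebra (ZMod p) (Fin 2) →ₗ[ZMod p]
      (Polynomial (ZMod p) ⊗[ZMod p] FreeNilp p c) := fun n =>
    (TensorProduct.mk (ZMod p) (Polynomial (ZMod p)) (FreeNilp p c) (Polynomial.X ^ (n + 1))) ∘ₗ
      (toFreeNilp p c : FreeLieAlgebra (ZMod p) (Fin 2) →ₗ[ZMod p] FreeNilp p c)
  have key : ∀ n, rightNormed (ZMod p) (FreeLieAlgebra.of (ZMod p)) n ≤
      LinearMap.eqLocus (weightHom p c : FreeLieAlgebra (ZMod p) (Fin 2) →ₗ[ZMod p] _) (T n) := by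
    intro n
    induction n with
    | zero =>
      rw [rightNormed, Submodule.span_le]
      rintro _ ⟨i, rfl⟩
      simp [T, weightHom, toFreeNilp_of]
    | succ n ih =>
      refine rightNormed_succ_le _ fun i u hu => ?_
      have hu : weightHom p c u = T n u := ih hu
      change weightHom p c _ = T (n + 1) _
      rw [LieHom.map_lie, hu]
      simp [T, weightHom, toFreeNilp_of, pow_succ']
  exact key n hu

/-- Such a u is a sum of pieces of weight above c. Each is sent to a power of t tensored with its
image in the quotient, which is 0. So the weight homomorphism descends to `FreeNilp`, and its t ^ k
coefficient is the projection to L_k; this makes the layers independent. -/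
theorem weightHom_eq_zero_of_mem {u : FreeLieAlgebra (ZMod p) (Fin 2)}
    (hu : u ∈ LieModule.lowerCentralSeries (ZMod p)
      (FreeLieAlgebra (ZMod p) (Fin 2)) (FreeLieAlgebra (ZMod p) (Fin 2)) c) :
    weightHom p c u = 0 := by
  have h : ⨆ n, rightNormed (ZMod p) (FreeLieAlgebra.of (ZMod p)) (c + n) ≤
      LinearMap.ker (weightHom p c).toLinearMap := by
    refine iSup_le fun n v hv => ?_
    change weightHom p c v = 0
    rw [weightHom_of_mem p c hv, (toFreeNilp_eq_zero_iff p c).2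
      (LieModule.antitone_lowerCentralSeries _ _ _ (Nat.le_add_right c n)
        (rightNormed_le_lowerCentralSeries p _ hv)), TensorProduct.tmul_zero]
  exact h (lowerCentralSeries_le_iSup_rightNormed (iSup_rightNormed_freeLieAlgebra _) c hu)

/-- The projection onto the component of weight `k`. -/
def proj (k : ℕ) : FreeNilp p c →ₗ[ZMod p] FreeNilp p c :=
  (TensorProduct.lid (ZMod p) (FreeNilp p c)).toLinearMap ∘ₗ
    (Polynomial.lcoeff (ZMod p) k).rTensor (FreeNilp p c) ∘ₗ
    (LieModule.lowerCentralSeries (ZMod p) (FreeLieAlgebra (ZMod p) (Fin 2))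
      (FreeLieAlgebra (ZMod p) (Fin 2)) c).toSubmodule.liftQ
        (weightHom p c).toLinearMap fun _ hu => weightHom_eq_zero_of_mem p c hu

theorem proj_toFreeNilp (k : ℕ) (u : FreeLieAlgebra (ZMod p) (Fin 2)) :
    proj p c k (toFreeNilp p c u) = TensorProduct.lid (ZMod p) (FreeNilp p c)
      ((Polynomial.lcoeff (ZMod p) k).rTensor (FreeNilp p c) (weightHom p c u)) := rfl

theorem proj_of_mem {j k : ℕ} {u : FreeNilp p c} (hu : u ∈ layer p c j) :
    proj p c k u = if j = k then u else 0 := by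
  rcases j with _ | j
  · rw [layer_zero, Submodule.mem_bot] at hu
    simp [hu]
  · rw [← map_toFreeNilp_rightNormed] at hu
    obtain ⟨v, hv, rfl⟩ := hu
    change proj p c k (toFreeNilp p c v) = if _ then toFreeNilp p c v else 0
    rw [proj_toFreeNilp, weightHom_of_mem p c hv]
    simp [Polynomial.coeff_X_pow, eq_comm]

theorem proj_self {k : ℕ} {u : FreeNilp p c} (hu : u ∈ layer p c k) : proj p c k u = u := by
  rw [proj_of_mem p c hu, if_pos rfl]

theorem map_proj_self {k : ℕ} {V : Submodule (ZMod p) (FreeNilp p c)} (hV : V ≤ layer p c k) :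
    V.map (proj p c k) = V := by
  ext u
  constructor
  · rintro ⟨v, hv, rfl⟩
    rwa [proj_self p c (hV hv)]
  · intro hu
    exact ⟨u, hu, proj_self p c (hV hu)⟩

theorem map_proj_of_ne {j k : ℕ} (hjk : j ≠ k) {V : Submodule (ZMod p) (FreeNilp p c)}
    (hV : V ≤ layer p c j) : V.map (proj p c k) = ⊥ := by
  rw [eq_bot_iff]
  rintro _ ⟨v, hv, rfl⟩
  simp [proj_of_mem p c (hV hv), hjk]

end Layers

/-! ### Two-step graded ideals as admissible triples, and their count. -/

section Ideals

variable (p c : ℕ)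

theorem gen_lie_mem_layer {j : ℕ} {u : FreeNilp p c} (hu : u ∈ layer p c j) (i : Fin 2) :
    ⁅gen p c i, u⁆ ∈ layer p c (j + 1) := by
  rcases j with _ | j
  · rw [layer_zero, Submodule.mem_bot] at hu
    change phi p c i u ∈ _
    rw [hu, map_zero]
    exact zero_mem _
  · rw [layer_succ] at hu ⊢
    exact lie_mem_rightNormed_succ _ hu i

theorem phiSum_le_iff {V W : Submodule (ZMod p) (FreeNilp p c)} :
    phiSum p c V ≤ W ↔ ∀ i, ∀ u ∈ V, ⁅gen p c i, u⁆ ∈ W := by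
  constructor
  · intro h i u hu
    fin_cases i
    · exact h (Submodule.mem_sup_left ⟨u, hu, rfl⟩)
    · exact h (Submodule.mem_sup_right ⟨u, hu, rfl⟩)
  · intro h
    refine sup_le ?_ ?_ <;> rintro _ ⟨u, hu, rfl⟩ <;> exact h _ u hu

theorem phiSum_le_layer {j : ℕ} {V : Submodule (ZMod p) (FreeNilp p c)} (hV : V ≤ layer p c j) :
    phiSum p c V ≤ layer p c (j + 1) :=
  (phiSum_le_iff p c).2 fun i _ hu => gen_lie_mem_layer p c (hV hu) i

/-- Stability under the two generators suffices for an ideal: by Jacobi it passes to right-normed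
brackets, and these span. -/
theorem lie_mem_of_gen_lie_mem {S : Submodule (ZMod p) (FreeNilp p c)}
    (h : ∀ i, ∀ u ∈ S, ⁅gen p c i, u⁆ ∈ S) (x : FreeNilp p c) {u : FreeNilp p c} (hu : u ∈ S) :
    ⁅x, u⁆ ∈ S := by
  have hx : x ∈ ⨆ n, layer p c (n + 1) := iSup_layer_succ p c ▸ Submodule.mem_top
  have key : ∀ n, ∀ w ∈ rightNormed (ZMod p) (gen p c) n, ∀ v ∈ S, ⁅w, v⁆ ∈ S := by
    intro n
    induction n with
    | zero =>
      intro w hw v hv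
      have : rightNormed (ZMod p) (gen p c) 0 ≤ S.comap
          ((LieAlgebra.ad (ZMod p) (FreeNilp p c) :
            FreeNilp p c →ₗ[ZMod p] Module.End (ZMod p) (FreeNilp p c)).flip v) := by
        rw [rightNormed, Submodule.span_le]
        rintro _ ⟨i, rfl⟩
        exact h i v hv
      exact this hw
    | succ n ih =>
      intro w hw v hv
      have : rightNormed (ZMod p) (gen p c) (n + 1) ≤ S.comap
          ((LieAlgebra.ad (ZMod p) (FreeNilp p c) :
            FreeNilp p c →ₗ[ZMod p] Module.End (ZMod p) (FreeNilp p c)).flip v) := by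
        refine rightNormed_succ_le _ fun i w hw => ?_
        change ⁅⁅gen p c i, w⁆, v⁆ ∈ S
        rw [lie_lie]
        exact sub_mem (h i _ (ih w hw v hv)) (ih w hw _ (h i v hv))
      exact this hw
  induction hx using Submodule.iSup_induction' with
  | mem n w hw => exact key n w (layer_succ p c n ▸ hw) u hu
  | zero => simp
  | add a b _ _ ha hb => rw [add_lie]; exact add_mem ha hb

/-- The sum of the components of weight at least `k`. -/
def tail (k : ℕ) : Submodule (ZMod p) (FreeNilp p c) := ⨆ j ∈ Icc k c, layer p c j

theorem layer_le_tail {j k : ℕ} (h : k ≤ j) : layer p c j ≤ tail p c k := by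
  by_cases hj : j ≤ c
  · exact le_iSup₂_of_le j (Finset.mem_Icc.2 ⟨h, hj⟩) le_rfl
  · rw [layer_eq_bot p c (by omega)]
    exact bot_le

theorem map_proj_tail {j k : ℕ} (h : j < k) : (tail p c k).map (proj p c j) = ⊥ := by
  simp only [tail, Submodule.map_iSup]
  simp only [eq_bot_iff, iSup_le_iff]
  intro i hi
  have := (Finset.mem_Icc.1 hi).1
  rw [map_proj_of_ne p c (by omega) le_rfl]

/-- The triples `(I_k, I_{k+1}, I_{k+2})` of components of a two-step graded ideal. -/
structure IsAdmissible (k : ℕ) (V₀ V₁ V₂ : Submodule (ZMod p) (FreeNilp p c)) : Prop where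
  le₀ : V₀ ≤ layer p c k
  le₁ : V₁ ≤ layer p c (k + 1)
  le₂ : V₂ ≤ layer p c (k + 2)
  phi₀ : phiSum p c V₀ ≤ V₁
  phi₁ : phiSum p c V₁ ≤ V₂

variable {p c}

/-- The two-step graded ideal with given components. -/
def IsAdmissible.ideal {k : ℕ} {V₀ V₁ V₂ : Submodule (ZMod p) (FreeNilp p c)}
    (h : IsAdmissible p c k V₀ V₁ V₂) : LieIdeal (ZMod p) (FreeNilp p c) :=
  { V₀ ⊔ V₁ ⊔ V₂ ⊔ tail p c (k + 3) with
    lie_mem := by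
      intro x u hu
      refine lie_mem_of_gen_lie_mem p c ?_ x hu
      rw [← phiSum_le_iff]
      simp only [phiSum, Submodule.map_sup]
      have h2 := phiSum_le_layer p c h.le₂
      have ht : phiSum p c (tail p c (k + 3)) ≤ tail p c (k + 3) := by
        simp only [phiSum, tail, Submodule.map_iSup, sup_le_iff, iSup_le_iff]
        constructor <;> rintro j hj _ ⟨u, hu, rfl⟩ <;>
        exact layer_le_tail p c (k := k + 3) (j := j + 1)
          (by have := (Finset.mem_Icc.1 hj).1; omega) (gen_lie_mem_layer p c hu _)
      have h0 := h.phi₀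
      have h1 := h.phi₁
      have h3 : layer p c (k + 2 + 1) ≤ tail p c (k + 3) := layer_le_tail p c le_rfl
      simp only [phiSum, sup_le_iff] at h0 h1 h2 ht ⊢
      have e1 : V₁ ≤ V₀ ⊔ V₁ ⊔ V₂ ⊔ tail p c (k + 3) :=
        le_sup_right.trans (le_sup_left.trans le_sup_left)
      have e2 : V₂ ≤ V₀ ⊔ V₁ ⊔ V₂ ⊔ tail p c (k + 3) := le_sup_right.trans le_sup_left
      have e3 : tail p c (k + 3) ≤ V₀ ⊔ V₁ ⊔ V₂ ⊔ tail p c (k + 3) := le_sup_right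
      exact ⟨⟨⟨⟨h0.1.trans e1, h1.1.trans e2⟩, (h2.1.trans h3).trans e3⟩, ht.1.trans e3⟩,
        ⟨⟨h0.2.trans e1, h1.2.trans e2⟩, (h2.2.trans h3).trans e3⟩, ht.2.trans e3⟩ }

theorem IsAdmissible.ideal_toSubmodule {k : ℕ} {V₀ V₁ V₂ : Submodule (ZMod p) (FreeNilp p c)}
    (h : IsAdmissible p c k V₀ V₁ V₂) :
    h.ideal.toSubmodule = V₀ ⊔ V₁ ⊔ V₂ ⊔ tail p c (k + 3) := rfl

theorem inf_layer_eq_of_map_proj {S V : Submodule (ZMod p) (FreeNilp p c)} {k : ℕ}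
    (hV : V ≤ layer p c k) (hVS : V ≤ S) (h : S.map (proj p c k) = V) :
    S ⊓ layer p c k = V := by
  refine le_antisymm ?_ (le_inf hVS hV)
  rintro u ⟨hu, hu'⟩
  rw [← h, ← proj_self p c hu']
  exact ⟨u, hu, rfl⟩

theorem IsAdmissible.inf_layer {k : ℕ} {V₀ V₁ V₂ : Submodule (ZMod p) (FreeNilp p c)}
    (h : IsAdmissible p c k V₀ V₁ V₂) :
    h.ideal.toSubmodule ⊓ layer p c k = V₀ ∧ h.ideal.toSubmodule ⊓ layer p c (k + 1) = V₁ ∧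
      h.ideal.toSubmodule ⊓ layer p c (k + 2) = V₂ := by
  rw [h.ideal_toSubmodule]
  refine ⟨inf_layer_eq_of_map_proj h.le₀ ?_ ?_, inf_layer_eq_of_map_proj h.le₁ ?_ ?_,
    inf_layer_eq_of_map_proj h.le₂ ?_ ?_⟩
  · exact (le_sup_left.trans le_sup_left).trans le_sup_left
  · simp only [Submodule.map_sup]
    rw [map_proj_self p c h.le₀, map_proj_of_ne p c (by omega) h.le₁,
      map_proj_of_ne p c (by omega) h.le₂, map_proj_tail p c (by omega)]
    simp
  · exact (le_sup_right.trans le_sup_left).trans le_sup_left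
  · simp only [Submodule.map_sup]
    rw [map_proj_self p c h.le₁, map_proj_of_ne p c (by omega) h.le₀,
      map_proj_of_ne p c (by omega) h.le₂, map_proj_tail p c (by omega)]
    simp
  · exact le_sup_right.trans le_sup_left
  · simp only [Submodule.map_sup]
    rw [map_proj_self p c h.le₂, map_proj_of_ne p c (by omega) h.le₀,
      map_proj_of_ne p c (by omega) h.le₁, map_proj_tail p c (by omega)]
    simp

theorem isStepGraded_two_iff {k : ℕ} {I : LieIdeal (ZMod p) (FreeNilp p c)} :
    IsStepGraded p c 2 k I ↔ I.toSubmodule = (I.toSubmodule ⊓ layer p c k) ⊔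
      (I.toSubmodule ⊓ layer p c (k + 1)) ⊔ (I.toSubmodule ⊓ layer p c (k + 2)) ⊔
        tail p c (k + 3) := by
  have : Icc k (k + 2) = {k, k + 1, k + 2} := by
    ext j; simp only [Finset.mem_Icc, Finset.mem_insert, Finset.mem_singleton]; omega
  rw [IsStepGraded, this, Finset.iSup_insert, Finset.iSup_insert, Finset.iSup_singleton, ← sup_assoc]
  rfl

theorem isAdmissible_inf_layer (k : ℕ) (I : LieIdeal (ZMod p) (FreeNilp p c)) :
    IsAdmissible p c k (I.toSubmodule ⊓ layer p c k) (I.toSubmodule ⊓ layer p c (k + 1))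
      (I.toSubmodule ⊓ layer p c (k + 2)) where
  le₀ := inf_le_right
  le₁ := inf_le_right
  le₂ := inf_le_right
  phi₀ := (phiSum_le_iff p c).2 fun _ _ hu =>
    ⟨I.lie_mem hu.1, gen_lie_mem_layer p c hu.2 _⟩
  phi₁ := (phiSum_le_iff p c).2 fun _ _ hu =>
    ⟨I.lie_mem hu.1, gen_lie_mem_layer p c hu.2 _⟩

/-- The components determine a two-step graded ideal. Conversely the sum of an admissible triple and
the tail is an ideal, whose components are recovered by the weight projections. -/
theorem alpha2_eq_ncard_isAdmissible (k a : ℕ) :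
    alpha2 p c k a = Set.ncard {V : Submodule (ZMod p) (FreeNilp p c) ×
        Submodule (ZMod p) (FreeNilp p c) × Submodule (ZMod p) (FreeNilp p c) |
      IsAdmissible p c k V.1 V.2.1 V.2.2 ∧ Module.finrank (ZMod p) V.1 +
        Module.finrank (ZMod p) V.2.1 + Module.finrank (ZMod p) V.2.2 = a} := by
  refine Set.ncard_congr (fun I _ => (I.toSubmodule ⊓ layer p c k,
    I.toSubmodule ⊓ layer p c (k + 1), I.toSubmodule ⊓ layer p c (k + 2))) ?_ ?_ ?_
  · exact fun I hI => ⟨isAdmissible_inf_layer k I, hI.2⟩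
  · intro I J hI hJ h
    simp only [Prod.mk.injEq] at h
    have h1 := isStepGraded_two_iff.1 hI.1
    have h2 := isStepGraded_two_iff.1 hJ.1
    rw [h.1, h.2.1, h.2.2, ← h2] at h1
    exact LieSubmodule.toSubmodule_injective h1
  · rintro ⟨V₀, V₁, V₂⟩ ⟨h, ha⟩
    obtain ⟨h0, h1, h2⟩ := h.inf_layer
    refine ⟨h.ideal, ⟨?_, ?_⟩, ?_⟩
    · rw [isStepGraded_two_iff, h0, h1, h2, h.ideal_toSubmodule]
    · unfold partDim
      rw [h0, h1, h2]
      exact ha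
    · simp only [h0, h1, h2]

variable (p c) in
/-- The number of ways to choose `I_{k+1}` and `I_{k+2}` once `dim I_k = m` and
`dim φ(I_k) = s`. -/
def extensionCount (k a m : ℕ) (s : ℤ) : ℚ :=
  ∑ m' ∈ Icc s (layerDim p c (k + 1) : ℤ),
    gaussBinom p (layerDim p c (k + 1) - s) (m' - s) *
      gaussBinom p (layerDim p c (k + 2) - 2 * m') (a - m - m' - 2 * m')

theorem innerSum_eq_extensionCount (k a m i : ℕ) :
    innerSum p c k a m i = extensionCount p c k a m (2 * m - i) := rfl

variable [Fact p.Prime]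

instance : Finite (FreeNilp p c) := Module.finite_of_finite (ZMod p)

instance : Finite (Submodule (ZMod p) (FreeNilp p c)) :=
  Finite.of_injective _ SetLike.coe_injective

instance : Fintype (Submodule (ZMod p) (FreeNilp p c)) := Fintype.ofFinite _

theorem sum_eq_sum_card_fiber_mul {α : Type*} (s : Finset α) (μ : α → ℕ) (M : ℕ)
    (hμ : ∀ x ∈ s, μ x < M) (g : ℕ → ℚ) :
    ∑ x ∈ s, g (μ x) = ∑ m ∈ range M, (#{x ∈ s | μ x = m} : ℚ) * g m := by
  rw [← Finset.sum_fiberwise_of_maps_to (t := range M) (g := μ)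
    (fun x hx => Finset.mem_range.2 (hμ x hx))]
  refine Finset.sum_congr rfl fun m _ => ?_
  rw [← nsmul_eq_mul, ← Finset.sum_const]
  exact Finset.sum_congr rfl fun x hx => by rw [(Finset.mem_filter.1 hx).2]

-- Group the V₁ between φ(V₀) and L_{k+1} by their dimension m'.
open scoped Classical in
theorem sum_phiSum_le_eq_extensionCount {k : ℕ}
    (a m : ℕ) {V₀ : Submodule (ZMod p) (FreeNilp p c)} (hV₀ : V₀ ≤ layer p c k) :
    ∑ V₁ : Submodule (ZMod p) (FreeNilp p c) with phiSum p c V₀ ≤ V₁ ∧ V₁ ≤ layer p c (k + 1),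
      gaussBinom p (layerDim p c (k + 2) - 2 * Module.finrank (ZMod p) V₁)
        (a - m - Module.finrank (ZMod p) V₁ - 2 * Module.finrank (ZMod p) V₁) =
      extensionCount p c k a m (Module.finrank (ZMod p) (phiSum p c V₀)) := by
  rw [sum_eq_sum_card_fiber_mul _
    (fun V₁ : Submodule (ZMod p) (FreeNilp p c) => Module.finrank (ZMod p) V₁) (layerDim p c (k + 1) + 1)
    (fun V₁ hV₁ => Nat.lt_succ_of_le (Submodule.finrank_mono (Finset.mem_filter.1 hV₁).2.2))
    (fun m' => gaussBinom p (layerDim p c (k + 2) - 2 * m') (a - m - m' - 2 * m'))]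
  rw [extensionCount]
  symm
  -- The integer interval starts at dim φ(V₀) ≥ 0, so it embeds into the naturals. Values of m'
  -- outside it have no V₁.
  refine Finset.sum_of_injOn Int.toNat ?_ ?_ ?_ ?_
  · intro x hx y hy h
    simp only [Finset.coe_Icc, Set.mem_Icc] at hx hy
    omega
  · intro x hx
    simp only [Finset.coe_Icc, Set.mem_Icc] at hx
    simp only [Finset.coe_range, Set.mem_Iio]
    omega
  · intro m' hm' hm
    rw [Finset.card_eq_zero.2, Nat.cast_zero, zero_mul]
    rw [Finset.filter_eq_empty_iff]
    rintro V₁ hV₁ rfl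
    refine hm ⟨Module.finrank (ZMod p) V₁, ?_, rfl⟩
    have h := (Finset.mem_filter.1 hV₁).2
    simp only [Finset.coe_Icc, Set.mem_Icc, Nat.cast_le]
    exact ⟨Submodule.finrank_mono h.1, Submodule.finrank_mono h.2⟩
  · intro m' hm'
    obtain ⟨h1, h2⟩ := Finset.mem_Icc.1 hm'
    lift m' to ℕ using by omega
    rw [Int.toNat_natCast]
    have h := ncard_subspaces_between (phiSum_le_layer p c hV₀) m'
    rw [ZMod.card] at h
    rw [layerDim, ← h, ncard_setOf_eq_card_filter, Finset.filter_filter]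
    simp only [and_assoc]

-- The hypothesis that φ doubles dimensions on L_{k+1} makes the number of V₂ depend on V₁ only
-- through its dimension.
open scoped Classical in
theorem alpha2_eq_sum {k : ℕ} (h2 : ∀ V ≤ layer p c (k + 1),
      Module.finrank (ZMod p) (phiSum p c V) = 2 * Module.finrank (ZMod p) V) (a : ℕ) :
    (alpha2 p c k a : ℚ) =
      ∑ V : Submodule (ZMod p) (FreeNilp p c) with V ≤ layer p c k,
        extensionCount p c k a (Module.finrank (ZMod p) V)
          (Module.finrank (ZMod p) (phiSum p c V)) := by
  have hcount : ∀ V₀ V₁ : Submodule (ZMod p) (FreeNilp p c), V₁ ≤ layer p c (k + 1) →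
      (#{V₂ : Submodule (ZMod p) (FreeNilp p c) | phiSum p c V₁ ≤ V₂ ∧ V₂ ≤ layer p c (k + 2) ∧
        Module.finrank (ZMod p) V₀ + Module.finrank (ZMod p) V₁ + Module.finrank (ZMod p) V₂ = a} :
          ℚ) = gaussBinom p (layerDim p c (k + 2) - 2 * Module.finrank (ZMod p) V₁)
        (a - Module.finrank (ZMod p) V₀ - Module.finrank (ZMod p) V₁ -
          2 * Module.finrank (ZMod p) V₁) := by
    intro V₀ V₁ hV₁
    set m := Module.finrank (ZMod p) V₀
    set m' := Module.finrank (ZMod p) V₁ with hm'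
    rcases le_or_gt (m + m') a with h | h
    · have hc := ncard_subspaces_between (phiSum_le_layer p c hV₁) (a - (m + m'))
      rw [h2 V₁ hV₁, ZMod.card, ← hm', ncard_setOf_eq_card_filter] at hc
      rw [show (a : ℤ) - m - m' - 2 * m' = ((a - (m + m') : ℕ) : ℤ) - ((2 * m' : ℕ) : ℤ) by omega,
        show 2 * (m' : ℤ) = ((2 * m' : ℕ) : ℤ) by omega, layerDim, ← hc]
      congr 2
      ext V₂
      simp only [Finset.mem_filter, Finset.mem_univ, true_and]
      refine and_congr_right fun _ => and_congr_right fun _ => ?_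
      omega
    -- Here dim V₀ + dim V₁ already exceeds a: no V₂ exists, and the binomial has negative lower
    -- index.
    · rw [gaussBinom, if_neg (by omega), if_neg (by omega), Finset.card_eq_zero.2, Nat.cast_zero]
      rw [Finset.filter_eq_empty_iff]
      rintro V₂ _ ⟨-, -, h3⟩
      omega
  rw [alpha2_eq_ncard_isAdmissible, ncard_setOf_eq_card_filter, Finset.card_filter,
    Fintype.sum_prod_type, Nat.cast_sum, Finset.sum_filter]
  refine Finset.sum_congr rfl fun V₀ _ => ?_
  split_ifs with h0
  · rw [← sum_phiSum_le_eq_extensionCount a _ h0, Fintype.sum_prod_type, Nat.cast_sum,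
      Finset.sum_filter]
    refine Finset.sum_congr rfl fun V₁ _ => ?_
    split_ifs with h1
    · rw [← hcount V₀ V₁ h1.2, ← Finset.card_filter]
      congr 2
      ext V₂
      simp only [Finset.mem_filter, Finset.mem_univ, true_and]
      exact ⟨fun h => ⟨h.1.phi₁, h.1.le₂, h.2⟩, fun h => ⟨⟨h0, h1.2, h.2.1, h1.1, h.1⟩, h.2.2⟩⟩
    · rw [Finset.sum_eq_zero, Nat.cast_zero]
      intro V₂ _
      rw [if_neg]
      exact fun h => h1 ⟨h.1.phi₀, h.1.le₁⟩
  · rw [Finset.sum_eq_zero, Nat.cast_zero]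
    intro V₂ _
    rw [if_neg]
    exact fun h => h0 h.1.le₀

end Ideals

/-! ### Lower bounds for d₃, d₅, d₇ from word coefficients. -/

section LowerBounds

attribute [local instance 100] LieRing.ofAssociativeRing

/-- The coefficient of the word `w` in the right-normed bracket `[s₁,[s₂,…,[x₀,x₁]]]`. -/
def bracketCoeff : List (Fin 2) → List (Fin 2) → ℤ
  | [], w => if w = [0, 1] then 1 else if w = [1, 0] then -1 else 0
  | i :: s, w => (if w.head? = some i then bracketCoeff s w.tail else 0) -
      if w.getLast? = some i then bracketCoeff s w.dropLast else 0

/-- The right-normed bracket `[s₁,[s₂,…,[x₀,x₁]]]`. -/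
def iteratedBracket {L : Type*} [LieRing L] (x : Fin 2 → L) : List (Fin 2) → L
  | [] => ⁅x 0, x 1⁆
  | i :: s => ⁅x i, iteratedBracket x s⁆

theorem iteratedBracket_mem_rightNormed {R L : Type*} [CommRing R] [LieRing L] [LieAlgebra R L]
    (x : Fin 2 → L) (s : List (Fin 2)) :
    iteratedBracket x s ∈ rightNormed R x (s.length + 1) := by
  induction s with
  | nil => exact lie_mem_rightNormed_succ x (Submodule.subset_span (Set.mem_range_self 1)) 0
  | cons i s ih => exact lie_mem_rightNormed_succ x ih i

variable (p : ℕ)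

/-- The map from the free Lie algebra to the free associative algebra. -/
def toWords : FreeLieAlgebra (ZMod p) (Fin 2) →ₗ⁅ZMod p⁆
    MonoidAlgebra (ZMod p) (FreeMonoid (Fin 2)) :=
  FreeLieAlgebra.lift (ZMod p) fun i => MonoidAlgebra.single (FreeMonoid.of i) 1

/-- The coefficient of a word. -/
def wordCoeff (w : List (Fin 2)) : FreeLieAlgebra (ZMod p) (Fin 2) →ₗ[ZMod p] ZMod p where
  toFun u := (toWords p u).coeff (FreeMonoid.ofList w)
  map_add' _ _ := by simp
  map_smul' _ _ := by simp

theorem coeff_single_of_mul {R : Type*} [Semiring R] (i : Fin 2)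
    (g : MonoidAlgebra R (FreeMonoid (Fin 2))) (w : List (Fin 2)) :
    (MonoidAlgebra.single (FreeMonoid.of i) 1 * g).coeff (FreeMonoid.ofList w) =
      if w.head? = some i then g.coeff (FreeMonoid.ofList w.tail) else 0 := by
  split_ifs with h
  · obtain ⟨t, rfl⟩ : ∃ t, w = i :: t := by
      cases w <;> simp_all
    rw [MonoidAlgebra.coeff_single_mul_eq_mul_coeff (FreeMonoid.ofList t), one_mul]
    · rfl
    · intro v _
      exact List.cons_eq_cons.trans (by simp; rfl)
  · refine MonoidAlgebra.coeff_single_mul_of_forall_mul_ne _ _ fun d hd => h ?_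
    have : w = i :: FreeMonoid.toList d := hd.symm
    simp [this]

theorem coeff_mul_single_of {R : Type*} [Semiring R] (i : Fin 2)
    (g : MonoidAlgebra R (FreeMonoid (Fin 2))) (w : List (Fin 2)) :
    (g * MonoidAlgebra.single (FreeMonoid.of i) 1).coeff (FreeMonoid.ofList w) =
      if w.getLast? = some i then g.coeff (FreeMonoid.ofList w.dropLast) else 0 := by
  split_ifs with h
  · obtain ⟨t, rfl⟩ : ∃ t, w = t ++ [i] := ⟨w.dropLast, by
      rw [List.dropLast_append_getLast? _ h]⟩
    rw [MonoidAlgebra.coeff_mul_single_eq_coeff_mul (FreeMonoid.ofList t), mul_one]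
    · simp
    · intro v _
      exact List.append_left_inj (s₁ := FreeMonoid.toList v) (s₂ := t) [i]
  · refine MonoidAlgebra.coeff_mul_single_of_forall_mul_ne _ _ fun d hd => h ?_
    have : w = FreeMonoid.toList d ++ [i] := hd.symm
    simp [this]

theorem wordCoeff_lie (i : Fin 2) (u : FreeLieAlgebra (ZMod p) (Fin 2)) (w : List (Fin 2)) :
    wordCoeff p w ⁅FreeLieAlgebra.of (ZMod p) i, u⁆ =
      (if w.head? = some i then wordCoeff p w.tail u else 0) -
        if w.getLast? = some i then wordCoeff p w.dropLast u else 0 := by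
  change (toWords p ⁅_, u⁆).coeff _ = _
  rw [LieHom.map_lie, LieRing.of_associative_ring_bracket, toWords, FreeLieAlgebra.lift_of_apply,
    MonoidAlgebra.coeff_sub, Finsupp.sub_apply, coeff_single_of_mul, coeff_mul_single_of]
  rfl

theorem wordCoeff_of (i : Fin 2) (w : List (Fin 2)) :
    wordCoeff p w (FreeLieAlgebra.of (ZMod p) i) = if w = [i] then 1 else 0 := by
  change (toWords p _).coeff _ = _
  rw [toWords, FreeLieAlgebra.lift_of_apply, MonoidAlgebra.coeff_single]
  classical
  rw [Finsupp.single_apply]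
  exact if_congr eq_comm rfl rfl

theorem wordCoeff_iteratedBracket (s w : List (Fin 2)) :
    wordCoeff p w (iteratedBracket (FreeLieAlgebra.of (ZMod p)) s) = (bracketCoeff s w : ℤ) := by
  induction s generalizing w with
  | nil =>
    rw [iteratedBracket, wordCoeff_lie, wordCoeff_of, wordCoeff_of, bracketCoeff]
    rcases w with _ | ⟨a, _ | ⟨b, _ | ⟨d, w⟩⟩⟩
    · simp
    · fin_cases a <;> simp
    · fin_cases a <;> fin_cases b <;> simp
    · simp
  | cons i s ih =>
    rw [iteratedBracket, wordCoeff_lie, bracketCoeff, ih, ih]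
    push_cast
    rfl

theorem wordCoeff_eq_zero_of_length_ne {n : ℕ} {u : FreeLieAlgebra (ZMod p) (Fin 2)}
    (hu : u ∈ rightNormed (ZMod p) (FreeLieAlgebra.of (ZMod p)) n) {w : List (Fin 2)}
    (hw : w.length ≠ n + 1) : wordCoeff p w u = 0 := by
  have key : ∀ n, ∀ w : List (Fin 2), w.length ≠ n + 1 →
      rightNormed (ZMod p) (FreeLieAlgebra.of (ZMod p)) n ≤ LinearMap.ker (wordCoeff p w) := by
    intro n
    induction n with
    | zero =>
      intro w hw
      rw [rightNormed, Submodule.span_le]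
      rintro _ ⟨i, rfl⟩
      change wordCoeff p w _ = 0
      rw [wordCoeff_of, if_neg]
      rintro rfl
      simp at hw
    | succ n ih =>
      intro w hw
      refine rightNormed_succ_le _ fun i u hu => ?_
      change wordCoeff p w _ = 0
      rw [wordCoeff_lie]
      by_cases h0 : w = []
      · simp [h0]
      · have h0 := List.length_pos_of_ne_nil h0
        have h1 : wordCoeff p w.tail u = 0 := ih _ (by rw [List.length_tail]; omega) hu
        have h2 : wordCoeff p w.dropLast u = 0 := ih _ (by rw [List.length_dropLast]; omega) hu
        simp [h1, h2]
  exact key n w hw hu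

/-- The coefficient of a word of length at most `c`, on the free nilpotent Lie algebra. -/
def nilpWordCoeff (c : ℕ) (w : List (Fin 2)) : FreeNilp p c →ₗ[ZMod p] ZMod p :=
  if hw : w.length ≤ c then
    (LieModule.lowerCentralSeries (ZMod p) (FreeLieAlgebra (ZMod p) (Fin 2))
      (FreeLieAlgebra (ZMod p) (Fin 2)) c).toSubmodule.liftQ (wordCoeff p w) <| by
    -- The quotiented term lives in weights above c, where words of length at most c have
    -- coefficient 0.
    refine (lowerCentralSeries_le_iSup_rightNormed (iSup_rightNormed_freeLieAlgebra _) c).trans ?_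
    exact iSup_le fun n u hu => wordCoeff_eq_zero_of_length_ne p hu (by omega)
  else 0

theorem nilpWordCoeff_iteratedBracket {c : ℕ} {w : List (Fin 2)} (hw : w.length ≤ c)
    (s : List (Fin 2)) :
    nilpWordCoeff p c w (iteratedBracket (gen p c) s) = (bracketCoeff s w : ℤ) := by
  have : iteratedBracket (gen p c) s =
      toFreeNilp p c (iteratedBracket (FreeLieAlgebra.of (ZMod p)) s) := by
    induction s with
    | nil => rfl
    | cons i s ih => rw [iteratedBracket, ih]; rfl
  rw [this, ← wordCoeff_iteratedBracket, nilpWordCoeff, dif_pos hw]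
  rfl

variable [Fact p.Prime]

/-- Brackets that have a dual system of integral combinations of word coefficients are linearly
independent. -/
theorem le_layerDim_of_dual {c n N : ℕ} (hc : n ≤ c) (S : Fin N → List (Fin 2))
    (B : Fin N → List (ℤ × List (Fin 2))) (hS : ∀ i, (S i).length + 2 = n)
    (hB : ∀ i, ∀ b ∈ B i, b.2.length = n)
    (hdual : ∀ i j, ((B i).map fun b => b.1 * bracketCoeff (S j) b.2).sum = if i = j then 1 else 0) :
    N ≤ layerDim p c n := by
  let g : Fin N → FreeNilp p c →ₗ[ZMod p] ZMod p := fun i =>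
    ((B i).map fun b => (b.1 : ZMod p) • nilpWordCoeff p c b.2).sum
  have hg : ∀ i j, g i (iteratedBracket (gen p c) (S j)) = if i = j then 1 else 0 := by
    intro i j
    have h1 : ∀ l : List (FreeNilp p c →ₗ[ZMod p] ZMod p), ∀ u, l.sum u = (l.map (· u)).sum := by
      intro l u
      induction l with
      | nil => simp
      | cons a l ih => simp [ih]
    have h2 := congrArg (Int.cast : ℤ → ZMod p) (hdual i j)
    rw [Int.cast_list_sum, List.map_map] at h2
    rw [h1, List.map_map]
    refine Eq.trans (congrArg List.sum (List.map_congr_left fun b hb => ?_)) (h2.trans (by simp))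
    simp [nilpWordCoeff_iteratedBracket p ((hB i b hb).le.trans hc)]
  have hli : LinearIndependent (ZMod p) fun j => iteratedBracket (gen p c) (S j) := by
    rw [Fintype.linearIndependent_iff]
    intro t ht i
    have := congrArg (g i) ht
    simpa [hg] using this
  have hmem : ∀ j, iteratedBracket (gen p c) (S j) ∈ layer p c n := by
    intro j
    rw [← hS j, layer_succ]
    exact iteratedBracket_mem_rightNormed _ _
  have hle : Submodule.span (ZMod p) (Set.range fun j => iteratedBracket (gen p c) (S j)) ≤
      layer p c n := by
    rw [Submodule.span_le]
    rintro _ ⟨j, rfl⟩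
    exact hmem j
  have := Submodule.finrank_mono hle
  rwa [finrank_span_eq_card hli, Fintype.card_fin] at this

theorem le_layerDim_three {c : ℕ} (hc : 3 ≤ c) : 2 ≤ layerDim p c 3 :=
  le_layerDim_of_dual p hc
    ![[0], [1]]
    ![[(1, [0, 0, 1])],
      [(-1, [0, 1, 1])]]
    (by decide +kernel) (by decide +kernel) (by decide +kernel)

theorem le_layerDim_five {c : ℕ} (hc : 5 ≤ c) : 6 ≤ layerDim p c 5 :=
  le_layerDim_of_dual p hc
    ![[0, 0, 0], [0, 0, 1], [0, 1, 1], [1, 0, 0], [1, 0, 1], [1, 1, 1]]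
    ![[(1, [0, 0, 0, 0, 1])],
      [(-3, [0, 0, 0, 1, 1]), (-1, [0, 0, 1, 0, 1])],
      [(-2, [0, 0, 1, 1, 1]), (-1, [0, 1, 0, 1, 1])],
      [(2, [0, 0, 0, 1, 1]), (1, [0, 0, 1, 0, 1])],
      [(3, [0, 0, 1, 1, 1]), (1, [0, 1, 0, 1, 1])],
      [(-1, [0, 1, 1, 1, 1])]]
    (by decide +kernel) (by decide +kernel) (by decide +kernel)

/-- The number 18 = (2⁷ - 2)/7 is Witt's dimension; likewise 6 = (2⁵ - 2)/5 in weight 5. The second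
table lists integral functionals dual to the chosen brackets. Integrality of this left inverse gives
independence modulo every prime. -/
theorem le_layerDim_seven {c : ℕ} (hc : 7 ≤ c) : 18 ≤ layerDim p c 7 :=
  le_layerDim_of_dual p hc
    ![[0, 0, 0, 0, 0], [0, 0, 0, 0, 1], [0, 0, 0, 1, 1], [0, 0, 1, 0, 0],
      [0, 0, 1, 0, 1], [0, 0, 1, 1, 1], [0, 1, 0, 0, 1], [0, 1, 0, 1, 1],
      [0, 1, 1, 1, 1], [1, 0, 0, 0, 0], [1, 0, 0, 0, 1], [1, 0, 0, 1, 1],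
      [1, 0, 1, 0, 0], [1, 0, 1, 0, 1], [1, 0, 1, 1, 1], [1, 1, 0, 0, 1],
      [1, 1, 0, 1, 1], [1, 1, 1, 1, 1]]
    ![[(1, [0, 0, 0, 0, 0, 0, 1])],
      [(-15, [0, 0, 0, 0, 0, 1, 1]), (-7, [0, 0, 0, 0, 1, 0, 1]),
        (-2, [0, 0, 0, 1, 0, 0, 1])],
      [(-8, [0, 0, 0, 0, 1, 1, 1]), (-5, [0, 0, 0, 1, 0, 1, 1]),
        (-2, [0, 0, 0, 1, 1, 0, 1]), (-2, [0, 0, 1, 0, 0, 1, 1]),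
        (-1, [0, 0, 1, 0, 1, 0, 1])],
      [(20, [0, 0, 0, 0, 0, 1, 1]), (10, [0, 0, 0, 0, 1, 0, 1]),
        (3, [0, 0, 0, 1, 0, 0, 1])],
      [(18, [0, 0, 0, 0, 1, 1, 1]), (12, [0, 0, 0, 1, 0, 1, 1]),
        (6, [0, 0, 0, 1, 1, 0, 1]), (5, [0, 0, 1, 0, 0, 1, 1]), (3, [0, 0, 1, 0, 1, 0, 1])],
      [(21, [0, 0, 0, 1, 1, 1, 1]), (7, [0, 0, 1, 0, 1, 1, 1]),
        (3, [0, 0, 1, 1, 0, 1, 1]), (3, [0, 0, 1, 1, 1, 0, 1]),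
        (-1, [0, 1, 0, 1, 0, 1, 1])],
      [(-3, [0, 0, 0, 1, 0, 1, 1]), (-3, [0, 0, 0, 1, 1, 0, 1]),
        (-2, [0, 0, 1, 0, 0, 1, 1]), (-2, [0, 0, 1, 0, 1, 0, 1])],
      [(-24, [0, 0, 0, 1, 1, 1, 1]), (-8, [0, 0, 1, 0, 1, 1, 1]),
        (-4, [0, 0, 1, 1, 0, 1, 1]), (-4, [0, 0, 1, 1, 1, 0, 1]),
        (1, [0, 1, 0, 1, 0, 1, 1])],
      [(6, [0, 0, 1, 1, 1, 1, 1]), (3, [0, 1, 0, 1, 1, 1, 1]), (1, [0, 1, 1, 0, 1, 1, 1])],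
      [(-6, [0, 0, 0, 0, 0, 1, 1]), (-3, [0, 0, 0, 0, 1, 0, 1]),
        (-1, [0, 0, 0, 1, 0, 0, 1])],
      [(-15, [0, 0, 0, 0, 1, 1, 1]), (-8, [0, 0, 0, 1, 0, 1, 1]),
        (-3, [0, 0, 0, 1, 1, 0, 1]), (-3, [0, 0, 1, 0, 0, 1, 1]),
        (-1, [0, 0, 1, 0, 1, 0, 1])],
      [(-16, [0, 0, 0, 1, 1, 1, 1]), (-5, [0, 0, 1, 0, 1, 1, 1]),
        (-2, [0, 0, 1, 1, 0, 1, 1]), (-2, [0, 0, 1, 1, 1, 0, 1]),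
        (1, [0, 1, 0, 1, 0, 1, 1])],
      [(6, [0, 0, 0, 0, 1, 1, 1]), (4, [0, 0, 0, 1, 0, 1, 1]), (2, [0, 0, 0, 1, 1, 0, 1]),
        (2, [0, 0, 1, 0, 0, 1, 1]), (1, [0, 0, 1, 0, 1, 0, 1])],
      [(12, [0, 0, 0, 1, 1, 1, 1]), (3, [0, 0, 1, 0, 1, 1, 1]),
        (2, [0, 0, 1, 1, 0, 1, 1]), (3, [0, 0, 1, 1, 1, 0, 1]),
        (-1, [0, 1, 0, 1, 0, 1, 1])],
      [(-15, [0, 0, 1, 1, 1, 1, 1]), (-7, [0, 1, 0, 1, 1, 1, 1]),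
        (-2, [0, 1, 1, 0, 1, 1, 1])],
      [(6, [0, 0, 0, 1, 1, 1, 1]), (3, [0, 0, 1, 0, 1, 1, 1]), (1, [0, 0, 1, 1, 0, 1, 1])],
      [(10, [0, 0, 1, 1, 1, 1, 1]), (4, [0, 1, 0, 1, 1, 1, 1]),
        (1, [0, 1, 1, 0, 1, 1, 1])],
      [(-1, [0, 1, 1, 1, 1, 1, 1])]]
    (by decide +kernel) (by decide +kernel) (by decide +kernel)

end LowerBounds

/-! ### Explicit relations [x, a] + [y, b] = 0 in weights 4 and 6. -/

section Relations

variable {L : Type*} [LieRing L] (x y : L)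

theorem lie_lie_lie_comm : ⁅x, ⁅y, ⁅x, y⁆⁆⁆ = ⁅y, ⁅x, ⁅x, y⁆⁆⁆ := by
  rw [← sub_eq_zero, ← lie_lie, lie_self]

theorem weight_four_relation : ⁅x, ⁅y, ⁅x, y⁆⁆⁆ + ⁅y, -⁅x, ⁅x, y⁆⁆⁆ = 0 := by
  rw [lie_neg, lie_lie_lie_comm, add_neg_cancel]

/-- With z = [x, y], the Leibniz rule gives [x, [z, [x, z]]] = [z, [x, [x, z]]] because [[x, z], [x,
z]] = 0. Expand each [z, ·] as a commutator of ad x and ad y. -/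
theorem weight_six_relation_left :
    ⁅x, (2 : ℤ) • ⁅y, ⁅x, ⁅x, ⁅x, y⁆⁆⁆⁆ - ⁅x, ⁅y, ⁅x, ⁅x, y⁆⁆⁆⁆⁆ +
      ⁅y, -⁅x, ⁅x, ⁅x, ⁅x, y⁆⁆⁆⁆⁆ = 0 := by
  have h1 := leibniz_lie x ⁅x, y⁆ ⁅x, ⁅x, y⁆⁆
  rw [lie_self, zero_add, lie_lie x y ⁅x, ⁅x, y⁆⁆, lie_lie x y ⁅x, ⁅x, ⁅x, y⁆⁆⁆, lie_sub] at h1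
  rw [lie_sub, lie_neg, lie_zsmul]
  linear_combination (norm := module) -h1

theorem weight_six_relation_right :
    ⁅x, ⁅y, ⁅y, ⁅y, ⁅x, y⁆⁆⁆⁆⁆ +
      ⁅y, ⁅y, ⁅y, ⁅x, ⁅x, y⁆⁆⁆⁆ - (2 : ℤ) • ⁅x, ⁅y, ⁅y, ⁅x, y⁆⁆⁆⁆⁆ = 0 := by
  have h1 := leibniz_lie y ⁅x, y⁆ ⁅y, ⁅x, y⁆⁆
  rw [lie_self, zero_add, lie_lie x y ⁅y, ⁅x, y⁆⁆, lie_lie x y ⁅y, ⁅y, ⁅x, y⁆⁆⁆, lie_sub,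
    lie_lie_lie_comm] at h1
  rw [lie_sub, lie_zsmul]
  linear_combination (norm := module) -h1

/-- Adding the Leibniz expansions of [x, [z, [y, z]]] and [y, [z, [x, z]]], with z = [x, y], cancels
[[x, z], [y, z]] against its opposite. -/
theorem weight_six_relation_middle :
    ⁅x, (3 : ℤ) • ⁅y, ⁅y, ⁅x, ⁅x, y⁆⁆⁆⁆ - ⁅x, ⁅y, ⁅y, ⁅x, y⁆⁆⁆⁆⁆ +
      ⁅y, ⁅y, ⁅x, ⁅x, ⁅x, y⁆⁆⁆⁆ - (3 : ℤ) • ⁅x, ⁅y, ⁅x, ⁅x, y⁆⁆⁆⁆⁆ = 0 := by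
  have h1 := leibniz_lie x ⁅x, y⁆ ⁅y, ⁅x, y⁆⁆
  have h2 := leibniz_lie y ⁅x, y⁆ ⁅x, ⁅x, y⁆⁆
  have h3 := lie_skew ⁅x, ⁅x, y⁆⁆ ⁅y, ⁅x, y⁆⁆
  rw [lie_lie x y ⁅y, ⁅x, y⁆⁆, lie_lie_lie_comm, lie_lie x y ⁅y, ⁅x, ⁅x, y⁆⁆⁆, lie_sub] at h1
  rw [lie_lie x y ⁅x, ⁅x, y⁆⁆, lie_lie x y ⁅y, ⁅x, ⁅x, y⁆⁆⁆, lie_sub] at h2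
  rw [lie_sub, lie_sub, lie_zsmul, lie_zsmul]
  linear_combination (norm := module) -h1 - h2 + h3

end Relations

/-! ### The kernel of (u, v) ↦ [X₁, u] + [X₂, v] and its presentation. -/

section Kernel

variable (p c : ℕ)

/-- The map `(u, v) ↦ [X₁, u] + [X₂, v]`. -/
def phiCoprod : FreeNilp p c × FreeNilp p c →ₗ[ZMod p] FreeNilp p c :=
  (phi p c 0).coprod (phi p c 1)

variable [Fact p.Prime]

theorem finrank_phiSum_add (V : Submodule (ZMod p) (FreeNilp p c)) :
    Module.finrank (ZMod p) (phiSum p c V) +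
      Module.finrank (ZMod p) ↥(LinearMap.ker (phiCoprod p c) ⊓ V.prod V) =
        2 * Module.finrank (ZMod p) V := by
  have h := finrank_map_add_finrank_ker_inf (phiCoprod p c) (V.prod V)
  rw [finrank_prod_submodule, ← two_mul] at h
  rw [← h, phiSum, ← LinearMap.map_coprod_prod]
  rfl

theorem layerDim_succ_le (k : ℕ) : layerDim p c (k + 2) ≤ 2 * layerDim p c (k + 1) := by
  rw [layerDim, layer_add_two]
  have := finrank_phiSum_add p c (layer p c (k + 1))
  rw [layerDim]
  omega

theorem ker_inf_prod_eq_bot {k : ℕ} (h : layerDim p c (k + 2) = 2 * layerDim p c (k + 1)) :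
    LinearMap.ker (phiCoprod p c) ⊓ (layer p c (k + 1)).prod (layer p c (k + 1)) = ⊥ := by
  have := finrank_phiSum_add p c (layer p c (k + 1))
  rw [← layer_add_two] at this
  rw [layerDim, layerDim] at h
  rw [← Submodule.finrank_eq_zero (R := ZMod p)]
  omega

theorem finrank_phiSum_of_layerDim {k : ℕ}
    (h : layerDim p c (k + 2) = 2 * layerDim p c (k + 1))
    {V : Submodule (ZMod p) (FreeNilp p c)} (hV : V ≤ layer p c (k + 1)) :
    Module.finrank (ZMod p) (phiSum p c V) = 2 * Module.finrank (ZMod p) V := by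
  have hV : LinearMap.ker (phiCoprod p c) ⊓ V.prod V = ⊥ := by
    rw [eq_bot_iff, ← ker_inf_prod_eq_bot p c h]
    exact inf_le_inf_left _ (Submodule.prod_mono hV hV)
  rw [← finrank_phiSum_add, hV, finrank_bot, add_zero]

theorem LambdaSucc_eq_bot {k : ℕ} (h : layerDim p c (k + 2) = 2 * layerDim p c (k + 1)) :
    LambdaSucc p c (k + 1) = ⊥ := by
  rw [eq_bot_iff]
  rintro w ⟨⟨u, hu, rfl⟩, ⟨v, hv, huv⟩⟩
  have hmem : (u, -v) ∈
      LinearMap.ker (phiCoprod p c) ⊓ (layer p c (k + 1)).prod (layer p c (k + 1)) := by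
    refine ⟨?_, hu, neg_mem hv⟩
    change phi p c 0 u + phi p c 1 (-v) = 0
    rw [map_neg, huv, add_neg_cancel]
  rw [ker_inf_prod_eq_bot p c h, Submodule.mem_bot, Prod.mk_eq_zero] at hmem
  rw [Submodule.mem_bot, hmem.1, map_zero]

/-- `A` and `B` describe `L_k` as `E ⊕ E` in such a way that the kernel of
`(u, v) ↦ [X₁, u] + [X₂, v]` on `L_k × L_k` consists of the pairs `(A e, B e)`. -/
structure IsPresentation (k n : ℕ) (A B : (Fin n → ZMod p) →ₗ[ZMod p] FreeNilp p c) : Prop where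
  injective : Function.Injective (A.coprod B)
  map_sup : (⊤ : Submodule (ZMod p) (Fin n → ZMod p)).map A ⊔
    (⊤ : Submodule (ZMod p) (Fin n → ZMod p)).map B = layer p c k
  range_eq : LinearMap.range (A.prod B) =
    LinearMap.ker (phiCoprod p c) ⊓ (layer p c k).prod (layer p c k)
  layerDim_zero : layerDim p c k = 2 * n
  layerDim_one : layerDim p c (k + 1) = 3 * n
  layerDim_two : layerDim p c (k + 2) = 6 * n

variable {p c}

/-- A dimension squeeze, with k + 1 the weight presented. Spanning and 2n ≤ d_{k+1} force A, B to
identify E ⊕ E with L_{k+1}. The n relations then give d_{k+2} ≤ 4n - n = 3n, so d_{k+3} ≤ 2 d_{k+2}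
≤ 6n. The assumed bound 6n ≤ d_{k+3} makes all of these equalities, so there are no further
relations. -/
theorem isPresentation_of_relations {k n : ℕ} (a b : Fin n → FreeNilp p c)
    (hspan : layer p c (k + 1) ≤
      Submodule.span (ZMod p) (Set.range a) ⊔ Submodule.span (ZMod p) (Set.range b))
    (hrel : ∀ i, ⁅gen p c 0, a i⁆ + ⁅gen p c 1, b i⁆ = 0)
    (h0 : 2 * n ≤ layerDim p c (k + 1)) (h2 : 6 * n ≤ layerDim p c (k + 3)) :
    IsPresentation p c (k + 1) n (Fintype.linearCombination (ZMod p) a)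
      (Fintype.linearCombination (ZMod p) b) := by
  set A := Fintype.linearCombination (ZMod p) a with hA
  set B := Fintype.linearCombination (ZMod p) b with hB
  have hrange : LinearMap.range (A.coprod B) =
      Submodule.span (ZMod p) (Set.range a) ⊔ Submodule.span (ZMod p) (Set.range b) := by
    rw [LinearMap.range_coprod, hA, hB, Fintype.range_linearCombination,
      Fintype.range_linearCombination]
  have hrk := (A.coprod B).finrank_range_add_finrank_ker
  rw [Module.finrank_prod, Module.finrank_fin_fun] at hrk
  rw [← hrange] at hspan
  have hle := Submodule.finrank_mono hspan
  rw [layerDim] at h0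
  have hlayer : layer p c (k + 1) = LinearMap.range (A.coprod B) :=
    Submodule.eq_of_le_of_finrank_eq hspan (by omega)
  have hinj : Function.Injective (A.coprod B) := by
    rw [← LinearMap.ker_eq_bot, ← Submodule.finrank_eq_zero (R := ZMod p)]
    omega
  have hsup : (⊤ : Submodule (ZMod p) (Fin n → ZMod p)).map A ⊔
      (⊤ : Submodule (ZMod p) (Fin n → ZMod p)).map B = layer p c (k + 1) := by
    rw [hlayer, LinearMap.range_coprod, Submodule.map_top, Submodule.map_top]
  have hAmem : ∀ e, A e ∈ layer p c (k + 1) := fun e => hsup ▸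
    Submodule.mem_sup_left ⟨e, Submodule.mem_top, rfl⟩
  have hBmem : ∀ e, B e ∈ layer p c (k + 1) := fun e => hsup ▸
    Submodule.mem_sup_right ⟨e, Submodule.mem_top, rfl⟩
  have hzero : phiCoprod p c ∘ₗ A.prod B = 0 := by
    refine LinearMap.pi_ext' fun i => ?_
    ext
    simpa [phiCoprod, hA, hB, Fintype.linearCombination_apply_single] using
      (show phi p c 0 (a i) + phi p c 1 (b i) = 0 from hrel i)
  have hrangele : LinearMap.range (A.prod B) ≤
      LinearMap.ker (phiCoprod p c) ⊓ (layer p c (k + 1)).prod (layer p c (k + 1)) := by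
    rintro _ ⟨e, rfl⟩
    exact ⟨LinearMap.congr_fun hzero e, hAmem e, hBmem e⟩
  have hAinj : Function.Injective (A.prod B) := by
    rw [← LinearMap.ker_eq_bot, LinearMap.ker_eq_bot']
    intro e he
    have he1 : A e = 0 := congrArg Prod.fst he
    have : A.coprod B (e, 0) = A.coprod B (0, 0) := by simp [he1]
    exact congrArg Prod.fst (hinj this)
  have hrk2 := LinearMap.finrank_range_of_inj hAinj
  rw [Module.finrank_fin_fun] at hrk2
  have h3 := finrank_phiSum_add p c (layer p c (k + 1))
  rw [← layer_add_two] at h3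
  have h4 : layerDim p c (k + 3) ≤ 2 * layerDim p c (k + 2) := layerDim_succ_le p c (k + 1)
  have h5 := Submodule.finrank_mono hrangele
  have h6 : layerDim p c (k + 2) = Module.finrank (ZMod p) (layer p c (k + 2)) := rfl
  have hd0 : Module.finrank (ZMod p) (layer p c (k + 1)) = 2 * n := by
    rw [← hlayer] at hrk
    omega
  refine ⟨hinj, hsup, Submodule.eq_of_le_of_finrank_eq hrangele ?_, hd0, ?_, ?_⟩
  · omega
  · change layerDim p c (k + 2) = 3 * n
    omega
  · change layerDim p c (k + 3) = 6 * n
    omega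

variable {k n : ℕ} {A B : (Fin n → ZMod p) →ₗ[ZMod p] FreeNilp p c}

theorem IsPresentation.layerDim_two_eq (h : IsPresentation p c k n A B) :
    layerDim p c (k + 2) = 2 * layerDim p c (k + 1) := by
  rw [h.layerDim_two, h.layerDim_one]
  ring

theorem IsPresentation.map_comap_inf_comap (h : IsPresentation p c k n A B)
    {V : Submodule (ZMod p) (FreeNilp p c)} (hV : V ≤ layer p c k) :
    (V.comap A ⊓ V.comap B).map (A.prod B) = LinearMap.ker (phiCoprod p c) ⊓ V.prod V := by
  ext w
  constructor
  · rintro ⟨e, ⟨h1, h2⟩, rfl⟩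
    have : A.prod B e ∈ LinearMap.range (A.prod B) := ⟨e, rfl⟩
    rw [h.range_eq] at this
    exact ⟨this.1, h1, h2⟩
  · rintro ⟨h1, h2⟩
    have : w ∈ LinearMap.range (A.prod B) := by
      rw [h.range_eq]
      exact ⟨h1, Submodule.prod_mono hV hV h2⟩
    obtain ⟨e, rfl⟩ := this
    exact ⟨e, ⟨h2.1, h2.2⟩, rfl⟩

theorem IsPresentation.injective_left (h : IsPresentation p c k n A B) : Function.Injective A := by
  intro e e' he
  have : A.coprod B (e, 0) = A.coprod B (e', 0) := by simp [he]
  exact congrArg Prod.fst (h.injective this)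

theorem IsPresentation.injective_right (h : IsPresentation p c k n A B) :
    Function.Injective B := by
  intro e e' he
  have : A.coprod B (0, e) = A.coprod B (0, e') := by simp [he]
  exact congrArg Prod.snd (h.injective this)

/-- The kernel on V × V is the image of A⁻¹V ∩ B⁻¹V under the injective map e ↦ (A e, B e), so that
intersection measures the defect. -/
theorem IsPresentation.finrank_phiSum_add (h : IsPresentation p c k n A B)
    {V : Submodule (ZMod p) (FreeNilp p c)} (hV : V ≤ layer p c k) :
    Module.finrank (ZMod p) (phiSum p c V) +
      Module.finrank (ZMod p) ↥(V.comap A ⊓ V.comap B) = 2 * Module.finrank (ZMod p) V := by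
  have hinj : Function.Injective (A.prod B) := fun e e' he =>
    h.injective_left (congrArg Prod.fst he)
  rw [← TwoStep.finrank_phiSum_add, ← h.map_comap_inf_comap hV,
    ← (Submodule.equivMapOfInjective (A.prod B) hinj _).finrank_eq]

/-- If [X₁, u] = 0, then (u, 0) = (A e, B e) for some e, and injectivity of B gives e = 0;
symmetrically for X₂. Injectivity of φ₁ and φ₂ on L_k is what turns the defect into the dimension of
collapse. -/
theorem IsPresentation.eq_zero_of_phi_eq_zero (h : IsPresentation p c k n A B) (i : Fin 2)
    {u : FreeNilp p c} (hu : u ∈ layer p c k) (hi : phi p c i u = 0) : u = 0 := by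
  fin_cases i
  · have : (u, 0) ∈ LinearMap.range (A.prod B) := by
      rw [h.range_eq]
      exact ⟨by simpa [phiCoprod] using hi, hu, zero_mem _⟩
    obtain ⟨e, he⟩ := this
    have h2 : B e = B 0 := (congrArg Prod.snd he).trans (map_zero B).symm
    rw [← show A e = u from congrArg Prod.fst he, h.injective_right h2, map_zero]
  · have : (0, u) ∈ LinearMap.range (A.prod B) := by
      rw [h.range_eq]
      exact ⟨by simpa [phiCoprod] using hi, zero_mem _, hu⟩
    obtain ⟨e, he⟩ := this
    have h2 : A e = A 0 := (congrArg Prod.fst he).trans (map_zero A).symm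
    rw [← show B e = u from congrArg Prod.snd he, h.injective_left h2, map_zero]

theorem IsPresentation.finrank_map_phi (h : IsPresentation p c k n A B) (i : Fin 2)
    {V : Submodule (ZMod p) (FreeNilp p c)} (hV : V ≤ layer p c k) :
    Module.finrank (ZMod p) (V.map (phi p c i)) = Module.finrank (ZMod p) V := by
  have hker : LinearMap.ker (phi p c i) ⊓ V = ⊥ := by
    rw [eq_bot_iff]
    exact fun u hu => h.eq_zero_of_phi_eq_zero i (hV hu.2) hu.1
  rw [← finrank_map_add_finrank_ker_inf (phi p c i) V, hker, finrank_bot, add_zero]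

theorem IsPresentation.finrank_phiSum_add_collapse (h : IsPresentation p c k n A B)
    {V : Submodule (ZMod p) (FreeNilp p c)} (hV : V ≤ layer p c k) :
    Module.finrank (ZMod p) (phiSum p c V) + Module.finrank (ZMod p) (collapse p c V) =
      2 * Module.finrank (ZMod p) V := by
  rw [phiSum, collapse, Submodule.finrank_sup_add_finrank_inf_eq, h.finrank_map_phi 0 hV,
    h.finrank_map_phi 1 hV, two_mul]

end Kernel

/-! ### Spanning sets in low weight and the presentations for k = 3 and k = 5. -/

section SmallLayers

variable (p c : ℕ)

theorem layer_one_le : layer p c 1 ≤ Submodule.span (ZMod p) (Set.range (gen p c)) := by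
  rw [layer_succ]
  exact le_rfl

theorem layer_add_two_le {k : ℕ} {s : Set (FreeNilp p c)} {W : Submodule (ZMod p) (FreeNilp p c)}
    (h : layer p c (k + 1) ≤ Submodule.span (ZMod p) s) (h0 : ∀ u ∈ s, ⁅gen p c 0, u⁆ ∈ W)
    (h1 : ∀ u ∈ s, ⁅gen p c 1, u⁆ ∈ W) : layer p c (k + 2) ≤ W := by
  rw [layer_add_two]
  exact sup_le (Submodule.map_le_iff_le_comap.2 (h.trans (Submodule.span_le.2 h0)))
    (Submodule.map_le_iff_le_comap.2 (h.trans (Submodule.span_le.2 h1)))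

theorem phi_gen_self (i : Fin 2) : phi p c i (gen p c i) = 0 := lie_self (gen p c i)

theorem phi_one_gen_zero : phi p c 1 (gen p c 0) = -phi p c 0 (gen p c 1) :=
  (lie_skew (gen p c 1) (gen p c 0)).symm

theorem layer_two_le :
    layer p c 2 ≤ Submodule.span (ZMod p) {⁅gen p c 0, gen p c 1⁆} := by
  have hz : ⁅gen p c 0, gen p c 1⁆ ∈ Submodule.span (ZMod p) {⁅gen p c 0, gen p c 1⁆} :=
    Submodule.subset_span rfl
  refine layer_add_two_le p c (layer_one_le p c) ?_ ?_ <;> rintro _ ⟨i, rfl⟩ <;> fin_cases i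
  · change phi p c 0 (gen p c 0) ∈ _
    rw [phi_gen_self]
    exact zero_mem _
  · exact hz
  · change phi p c 1 (gen p c 0) ∈ _
    rw [phi_one_gen_zero]
    exact neg_mem hz
  · change phi p c 1 (gen p c 1) ∈ _
    rw [phi_gen_self]
    exact zero_mem _

theorem layer_three_le : layer p c 3 ≤ Submodule.span (ZMod p)
    {⁅gen p c 0, ⁅gen p c 0, gen p c 1⁆⁆, ⁅gen p c 1, ⁅gen p c 0, gen p c 1⁆⁆} := by
  refine layer_add_two_le p c (layer_two_le p c) ?_ ?_ <;> rintro _ rfl <;>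
    exact Submodule.subset_span (by simp)

theorem layer_four_le : layer p c 4 ≤ Submodule.span (ZMod p)
    {⁅gen p c 0, ⁅gen p c 0, ⁅gen p c 0, gen p c 1⁆⁆⁆,
      ⁅gen p c 1, ⁅gen p c 0, ⁅gen p c 0, gen p c 1⁆⁆⁆,
      ⁅gen p c 1, ⁅gen p c 1, ⁅gen p c 0, gen p c 1⁆⁆⁆} := by
  refine layer_add_two_le p c (layer_three_le p c) ?_ ?_ <;> rintro _ (rfl | rfl) <;>
    refine Submodule.subset_span ?_
  · exact Or.inl rfl
  · exact Or.inr (Or.inl (lie_lie_lie_comm _ _))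
  · exact Or.inr (Or.inl rfl)
  · exact Or.inr (Or.inr rfl)

variable [Fact p.Prime]

theorem layerDim_one_le : layerDim p c 1 ≤ 2 :=
  (Submodule.finrank_mono (layer_one_le p c)).trans
    ((finrank_range_le_card _).trans (by simp))

theorem layerDim_two_le : layerDim p c 2 ≤ 1 :=
  (Submodule.finrank_mono (layer_two_le p c)).trans ((finrank_span_le_card _).trans (by simp))

variable {p c}

theorem layerDim_two (hc : 3 ≤ c) : layerDim p c 2 = 1 := by
  have h1 := le_layerDim_three p hc
  have h2 : layerDim p c 3 ≤ 2 * layerDim p c 2 := layerDim_succ_le p c 1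
  have h3 := layerDim_two_le p c
  omega

theorem layerDim_three (hc : 3 ≤ c) : layerDim p c 3 = 2 := by
  have h1 := le_layerDim_three p hc
  have h2 : layerDim p c 3 ≤ 2 * layerDim p c 2 := layerDim_succ_le p c 1
  have h3 := layerDim_two_le p c
  omega

theorem exists_isPresentation_three (hc : 5 ≤ c) : ∃ A B, IsPresentation p c 3 1 A B := by
  let a : Fin 1 → FreeNilp p c := ![⁅gen p c 1, ⁅gen p c 0, gen p c 1⁆⁆]
  let b : Fin 1 → FreeNilp p c := ![-⁅gen p c 0, ⁅gen p c 0, gen p c 1⁆⁆]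
  refine ⟨_, _, isPresentation_of_relations (k := 2) a b ?_ ?_
    (le_layerDim_three p (by omega)) (le_layerDim_five p hc)⟩
  · set W := Submodule.span (ZMod p) (Set.range a) ⊔ Submodule.span (ZMod p) (Set.range b)
    have ha : a 0 ∈ W := Submodule.mem_sup_left (Submodule.subset_span ⟨0, rfl⟩)
    have hb : b 0 ∈ W := Submodule.mem_sup_right (Submodule.subset_span ⟨0, rfl⟩)
    refine (layer_three_le p c).trans (Submodule.span_le.2 ?_)
    rintro _ (rfl | rfl)
    · rw [← neg_neg ⁅gen p c 0, _⁆]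
      exact neg_mem hb
    · exact ha
  · intro i
    fin_cases i
    exact weight_four_relation (gen p c 0) (gen p c 1)

/-- The pairs (a i, b i) are the three weight 6 relations. What remains is that their entries span
L₅. -/
theorem exists_isPresentation_five (hc : 7 ≤ c) (hp : 7 ≤ p) :
    ∃ A B, IsPresentation p c 5 3 A B := by
  let r₁ := ⁅gen p c 0, ⁅gen p c 0, ⁅gen p c 0, gen p c 1⁆⁆⁆
  let r₂ := ⁅gen p c 1, ⁅gen p c 0, ⁅gen p c 0, gen p c 1⁆⁆⁆
  let r₃ := ⁅gen p c 1, ⁅gen p c 1, ⁅gen p c 0, gen p c 1⁆⁆⁆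
  let a : Fin 3 → FreeNilp p c := ![(2 : ℤ) • ⁅gen p c 1, r₁⁆ - ⁅gen p c 0, r₂⁆,
    (3 : ℤ) • ⁅gen p c 1, r₂⁆ - ⁅gen p c 0, r₃⁆, ⁅gen p c 1, r₃⁆]
  let b : Fin 3 → FreeNilp p c := ![-⁅gen p c 0, r₁⁆,
    ⁅gen p c 1, r₁⁆ - (3 : ℤ) • ⁅gen p c 0, r₂⁆, ⁅gen p c 1, r₂⁆ - (2 : ℤ) • ⁅gen p c 0, r₃⁆]
  refine ⟨_, _, isPresentation_of_relations (k := 4) a b ?_ ?_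
    (le_layerDim_five p (by omega)) (le_layerDim_seven p hc)⟩
  · set W := Submodule.span (ZMod p) (Set.range a) ⊔ Submodule.span (ZMod p) (Set.range b)
    have ha : ∀ i, a i ∈ W := fun i => Submodule.mem_sup_left (Submodule.subset_span ⟨i, rfl⟩)
    have hb : ∀ i, b i ∈ W := fun i => Submodule.mem_sup_right (Submodule.subset_span ⟨i, rfl⟩)
    -- The entries a 0, b 1 are combinations of [X₂, r₁], [X₁, r₂], and a 1, b 2 of [X₂, r₂], [X₁,
    -- r₃]. Both 2 × 2 systems have determinant ±5, so solving them requires 5 to be invertible.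
    have hfive : (5 : ZMod p) ≠ 0 := by
      have : ((5 : ℕ) : ZMod p) ≠ 0 := by
        rw [Ne, ZMod.natCast_eq_zero_iff]
        exact fun h => by have := Nat.le_of_dvd (by norm_num) h; omega
      exact_mod_cast this
    have hW : ∀ u : FreeNilp p c, (5 : ℤ) • u ∈ W → u ∈ W := by
      intro u hu
      rw [← Int.cast_smul_eq_zsmul (ZMod p)] at hu
      exact (W.smul_mem_iff (by exact_mod_cast hfive)).1 hu
    have hz : ∀ (t : ℤ) u, u ∈ W → t • u ∈ W := fun t u hu => W.toAddSubgroup.zsmul_mem hu t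
    refine layer_add_two_le p c (layer_four_le p c) ?_ ?_
    · rintro _ (rfl | rfl | rfl)
      · rw [← neg_neg ⁅gen p c 0, _⁆]
        exact neg_mem (hb 0)
      · refine hW _ ?_
        have : (5 : ℤ) • ⁅gen p c 0, r₂⁆ = a 0 - (2 : ℤ) • b 1 := by
          change _ = ((2 : ℤ) • ⁅gen p c 1, r₁⁆ - ⁅gen p c 0, r₂⁆) -
            (2 : ℤ) • (⁅gen p c 1, r₁⁆ - (3 : ℤ) • ⁅gen p c 0, r₂⁆)
          module
        rw [this]
        exact sub_mem (ha 0) (hz _ _ (hb 1))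
      · refine hW _ ?_
        have : (5 : ℤ) • ⁅gen p c 0, r₃⁆ = a 1 - (3 : ℤ) • b 2 := by
          change _ = ((3 : ℤ) • ⁅gen p c 1, r₂⁆ - ⁅gen p c 0, r₃⁆) -
            (3 : ℤ) • (⁅gen p c 1, r₂⁆ - (2 : ℤ) • ⁅gen p c 0, r₃⁆)
          module
        rw [this]
        exact sub_mem (ha 1) (hz _ _ (hb 2))
    · rintro _ (rfl | rfl | rfl)
      · refine hW _ ?_
        have : (5 : ℤ) • ⁅gen p c 1, r₁⁆ = (3 : ℤ) • a 0 - b 1 := by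
          change _ = (3 : ℤ) • ((2 : ℤ) • ⁅gen p c 1, r₁⁆ - ⁅gen p c 0, r₂⁆) -
            (⁅gen p c 1, r₁⁆ - (3 : ℤ) • ⁅gen p c 0, r₂⁆)
          module
        rw [this]
        exact sub_mem (hz _ _ (ha 0)) (hb 1)
      · refine hW _ ?_
        have : (5 : ℤ) • ⁅gen p c 1, r₂⁆ = (2 : ℤ) • a 1 - b 2 := by
          change _ = (2 : ℤ) • ((3 : ℤ) • ⁅gen p c 1, r₂⁆ - ⁅gen p c 0, r₃⁆) -
            (⁅gen p c 1, r₂⁆ - (2 : ℤ) • ⁅gen p c 0, r₃⁆)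
          module
        rw [this]
        exact sub_mem (hz _ _ (ha 1)) (hb 2)
      · exact ha 2
  · intro i
    fin_cases i
    · exact weight_six_relation_left (gen p c 0) (gen p c 1)
    · exact weight_six_relation_middle (gen p c 0) (gen p c 1)
    · exact weight_six_relation_right (gen p c 0) (gen p c 1)

theorem layerDim_eq_two_mul {k : ℕ} (hk : k = 1 ∨ k = 3 ∨ k = 5) (hkc : k + 2 ≤ c) (hcp : c ≤ p) :
    layerDim p c (k + 2) = 2 * layerDim p c (k + 1) := by
  rcases hk with rfl | rfl | rfl
  · rw [layerDim_three hkc, layerDim_two hkc]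
  · obtain ⟨A, B, h⟩ := exists_isPresentation_three (p := p) hkc
    exact h.layerDim_two_eq
  · obtain ⟨A, B, h⟩ := exists_isPresentation_five (p := p) hkc (hkc.trans hcp)
    exact h.layerDim_two_eq

theorem lie_gen_ne_zero (hc : 3 ≤ c) : ⁅gen p c 0, gen p c 1⁆ ≠ 0 := by
  intro h
  have h1 := layerDim_two (p := p) hc
  have h2 := Submodule.finrank_mono (layer_two_le p c)
  rw [h, Submodule.span_zero_singleton, finrank_bot] at h2
  rw [layerDim] at h1
  omega

/-- Bracketing t₀X₁ + t₁X₂ with X₁ and X₂ isolates t₁ and t₀ up to sign, as multiples of [X₁, X₂] ≠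
0. -/
theorem eq_zero_of_phi_sum_eq_zero (hc : 3 ≤ c) {t : Fin 2 → ZMod p}
    (h : ∀ i, phi p c i (∑ j, t j • gen p c j) = 0) : t = 0 := by
  have hz : phi p c 0 (gen p c 1) ≠ 0 := lie_gen_ne_zero hc
  have e0 := h 0
  have e1 := h 1
  rw [Fin.sum_univ_two, map_add, map_smul, map_smul, phi_gen_self, smul_zero] at e0 e1
  rw [zero_add, smul_eq_zero_iff_left hz] at e0
  rw [add_zero, phi_one_gen_zero, smul_neg, neg_eq_zero, smul_eq_zero_iff_left hz] at e1
  ext i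
  fin_cases i
  · exact e1
  · exact e0

/-- The subspaces of `L_1` of positive dimension have `φ(V) = L_2`. -/
theorem finrank_phiSum_of_le_layer_one (hc : 3 ≤ c) {V : Submodule (ZMod p) (FreeNilp p c)}
    (hV : V ≤ layer p c 1) :
    Module.finrank (ZMod p) (phiSum p c V) = if Module.finrank (ZMod p) V = 0 then 0 else 1 := by
  split_ifs with h
  · rw [Submodule.finrank_eq_zero] at h
    rw [h, phiSum, Submodule.map_bot, Submodule.map_bot, sup_bot_eq, finrank_bot]
  · have hle := Submodule.finrank_mono (phiSum_le_layer p c hV)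
    have h1 : Module.finrank (ZMod p) (layer p c (1 + 1)) = 1 := layerDim_two (p := p) hc
    have hpos : Module.finrank (ZMod p) (phiSum p c V) ≠ 0 := by
      intro h0
      rw [Submodule.finrank_eq_zero, eq_bot_iff, phiSum_le_iff] at h0
      refine h (Submodule.finrank_eq_zero.2 (eq_bot_iff.2 fun u hu => ?_))
      obtain ⟨t, rfl⟩ := (Submodule.mem_span_range_iff_exists_fun _).1 (layer_one_le p c (hV hu))
      rw [eq_zero_of_phi_sum_eq_zero hc fun i => h0 i _ hu]
      simp
    omega

theorem layerDim_one (hc : 3 ≤ c) : layerDim p c 1 = 2 := by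
  refine le_antisymm (layerDim_one_le p c) ?_
  have hli : LinearIndependent (ZMod p) (gen p c) := by
    rw [Fintype.linearIndependent_iff]
    intro t ht
    exact congrFun (eq_zero_of_phi_sum_eq_zero hc fun i => by rw [ht, map_zero])
  rw [layerDim, layer_succ, rightNormed, finrank_span_eq_card hli, Fintype.card_fin]

end SmallLayers

/-! ### The counting formulas and their polynomiality. -/

section Formulas

variable {p c : ℕ} [Fact p.Prime]

/-- The defect is an abstract function ι so that it can be read in three ways: as 2 dim V - dim
φ(V), as the dimension of collapse, and as dim(A⁻¹V ∩ B⁻¹V). -/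
theorem alpha2_eq_sum_of_defect {k : ℕ} (h2 : layerDim p c (k + 2) = 2 * layerDim p c (k + 1))
    (ι : Submodule (ZMod p) (FreeNilp p c) → ℕ) (N : ℕ → ℕ)
    (hN : ∀ V ≤ layer p c k, ι V < N (Module.finrank (ZMod p) V))
    (hι : ∀ V ≤ layer p c k,
      Module.finrank (ZMod p) (phiSum p c V) + ι V = 2 * Module.finrank (ZMod p) V) (a : ℕ) :
    (alpha2 p c k a : ℚ) = ∑ m ∈ range (layerDim p c k + 1), ∑ i ∈ range (N m),
      (Set.ncard {V : Submodule (ZMod p) (FreeNilp p c) | V ≤ layer p c k ∧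
        Module.finrank (ZMod p) V = m ∧ ι V = i} : ℚ) * innerSum p c k a m i := by
  classical
  rw [alpha2_eq_sum (fun V hV => finrank_phiSum_of_layerDim p c h2 hV),
    ← Finset.sum_fiberwise_of_maps_to (t := range (layerDim p c k + 1))
    (g := fun V : Submodule (ZMod p) (FreeNilp p c) => Module.finrank (ZMod p) V)
    (fun V hV => Finset.mem_range.2 (Nat.lt_succ_of_le
      (Submodule.finrank_mono (Finset.mem_filter.1 hV).2)))]
  refine Finset.sum_congr rfl fun m _ => ?_
  rw [Finset.filter_filter]
  have hterm : ∀ V ∈ ({V | V ≤ layer p c k ∧ Module.finrank (ZMod p) V = m} :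
      Finset (Submodule (ZMod p) (FreeNilp p c))),
      extensionCount p c k a (Module.finrank (ZMod p) V)
        (Module.finrank (ZMod p) (phiSum p c V)) = innerSum p c k a m (ι V) := by
    intro V hV
    obtain ⟨hVk, rfl⟩ := (Finset.mem_filter.1 hV).2
    rw [innerSum_eq_extensionCount]
    congr 1
    have := hι V hVk
    omega
  rw [Finset.sum_congr rfl hterm, sum_eq_sum_card_fiber_mul _ ι (N m) _ (innerSum p c k a m)]
  · refine Finset.sum_congr rfl fun i _ => ?_
    rw [ncard_setOf_eq_card_filter, Finset.filter_filter]
    simp only [and_assoc]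
  · intro V hV
    obtain ⟨hVk, rfl⟩ := (Finset.mem_filter.1 hV).2
    exact hN V hVk

theorem alpha2_eq_sum_fDefect {k : ℕ} (h2 : layerDim p c (k + 2) = 2 * layerDim p c (k + 1))
    (a : ℕ) :
    (alpha2 p c k a : ℚ) = ∑ m ∈ range (layerDim p c k + 1), ∑ i ∈ range (2 * m + 1),
      (fDefect p c k m i : ℚ) * innerSum p c k a m i := by
  have hle : ∀ V : Submodule (ZMod p) (FreeNilp p c),
      Module.finrank (ZMod p) (phiSum p c V) ≤ 2 * Module.finrank (ZMod p) V := fun V => by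
    rw [← finrank_phiSum_add]
    exact Nat.le_add_right _ _
  rw [alpha2_eq_sum_of_defect h2 (fun V => 2 * Module.finrank (ZMod p) V -
    Module.finrank (ZMod p) (phiSum p c V)) (fun m => 2 * m + 1) (fun V _ => by omega)
    (fun V _ => by have := hle V; omega)]
  refine Finset.sum_congr rfl fun m _ => Finset.sum_congr rfl fun i _ => ?_
  rw [fDefect]
  congr 3
  ext V
  refine and_congr_right fun _ => and_congr_right fun hm => ?_
  have := hle V
  omega

variable {k n : ℕ} {A B : (Fin n → ZMod p) →ₗ[ZMod p] FreeNilp p c}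

theorem IsPresentation.alpha2_eq_sum_f (h : IsPresentation p c k n A B) (a : ℕ) :
    (alpha2 p c k a : ℚ) = ∑ m ∈ range (layerDim p c k + 1), ∑ i ∈ range (lSucc p c k + 1),
      (f p c k m i : ℚ) * innerSum p c k a m i :=
  alpha2_eq_sum_of_defect h.layerDim_two_eq (fun V => Module.finrank (ZMod p) (collapse p c V))
    (fun _ => lSucc p c k + 1)
    (fun _ hV => Nat.lt_succ_of_le (Submodule.finrank_mono
      (inf_le_inf (Submodule.map_mono hV) (Submodule.map_mono hV))))
    (fun _ hV => h.finrank_phiSum_add_collapse hV) a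

theorem sum_innerSum_polynomial (d₁ d₂ a m : ℕ) (s : ℤ) :
    ∃ P : Polynomial ℚ, ∀ q : ℕ, 2 ≤ q →
      ∑ m' ∈ Icc s (d₁ : ℤ), gaussBinom q (d₁ - s) (m' - s) *
        gaussBinom q (d₂ - 2 * m') (a - m - m' - 2 * m') = P.eval (q : ℚ) := by
  choose P hP using fun m' : ℤ => gaussBinom_polynomial (d₁ - s) (m' - s)
  choose Q hQ using fun m' : ℤ => gaussBinom_polynomial (d₂ - 2 * m') (a - m - m' - 2 * m')
  refine ⟨∑ m' ∈ Icc s (d₁ : ℤ), P m' * Q m', fun q hq => ?_⟩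
  rw [Polynomial.eval_finsetSum]
  refine Finset.sum_congr rfl fun m' _ => ?_
  rw [Polynomial.eval_mul, hP m' q hq, hQ m' q hq]

/-- The layer dimensions 2n, 3n, 6n and the equations for the counts by defect involve only n, m and
p. All polynomials can therefore be chosen before c and p. -/
theorem IsPresentation.alpha2_polynomial (k n a : ℕ) :
    ∃ P : Polynomial ℚ, ∀ (c p : ℕ) [Fact p.Prime] (A B : (Fin n → ZMod p) →ₗ[ZMod p] FreeNilp p c),
      IsPresentation p c k n A B → (alpha2 p c k a : ℚ) = P.eval (p : ℚ) := by
  choose S hS using fun m i : ℕ => sum_innerSum_polynomial (3 * n) (6 * n) a m (2 * m - i)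
  have hR : ∀ m j : ℕ, ∃ P : Polynomial ℚ, ∀ q : ℕ, 2 ≤ q →
      gaussBinom q n j * gaussBinom q (2 * n - 2 * j) (m - 2 * j) = P.eval (q : ℚ) := by
    intro m j
    obtain ⟨P, hP⟩ := gaussBinom_polynomial n j
    obtain ⟨Q, hQ⟩ := gaussBinom_polynomial (2 * n - 2 * j) (m - 2 * j)
    exact ⟨P * Q, fun q hq => by rw [Polynomial.eval_mul, hP q hq, hQ q hq]⟩
  have hF : ∀ m i : ℕ, ∃ P : Polynomial ℚ, i ≤ n → ∀ (q : ℕ) (h : ℕ → ℚ), 2 ≤ q →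
      (∀ j ≤ n, ∑ i ∈ range (n + 1), h i * gaussBinom q i j =
        gaussBinom q n j * gaussBinom q (2 * n - 2 * j) (m - 2 * j)) → h i = P.eval (q : ℚ) := by
    intro m i
    by_cases hi : i ≤ n
    · obtain ⟨P, hP⟩ := polynomial_of_sum_mul_gaussBinom n
        (fun q j => gaussBinom q n j * gaussBinom q (2 * n - 2 * j) (m - 2 * j)) (hR m) i hi
      exact ⟨P, fun _ => hP⟩
    · exact ⟨0, fun h => absurd h hi⟩
  choose F hF using hF
  refine ⟨∑ m ∈ range (2 * n + 1), ∑ i ∈ range (n + 1), F m i * S m i, fun c p _ A B h => ?_⟩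
  have hp2 : 2 ≤ p := (Fact.out : p.Prime).two_le
  rw [alpha2_eq_sum_of_defect h.layerDim_two_eq
    (fun V => Module.finrank (ZMod p) ↥(V.comap A ⊓ V.comap B)) (fun _ => n + 1)
    (fun V _ => Nat.lt_succ_of_le ((Submodule.finrank_le _).trans
      (Module.finrank_fin_fun (ZMod p)).le))
    (fun V hV => h.finrank_phiSum_add hV), h.layerDim_zero, Polynomial.eval_finsetSum]
  refine Finset.sum_congr rfl fun m _ => ?_
  rw [Polynomial.eval_finsetSum]
  refine Finset.sum_congr rfl fun i hi => ?_
  rw [Polynomial.eval_mul]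
  congr 1
  · refine hF m i (Nat.le_of_lt_succ (Finset.mem_range.1 hi)) p (fun i =>
      (Set.ncard {V : Submodule (ZMod p) (FreeNilp p c) | V ≤ layer p c k ∧
        Module.finrank (ZMod p) V = m ∧
          Module.finrank (ZMod p) ↥(V.comap A ⊓ V.comap B) = i} : ℚ)) hp2 fun j _ => ?_
    have := sum_ncard_mul_gaussBinom h.injective h.map_sup m j
    rwa [Module.finrank_fin_fun, ZMod.card] at this
  · rw [← hS m i p hp2, innerSum, h.layerDim_one, h.layerDim_two]

theorem alpha2_one_polynomial (a : ℕ) :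
    ∃ P : Polynomial ℚ, ∀ (c p : ℕ) [Fact p.Prime], 3 ≤ c →
      (alpha2 p c 1 a : ℚ) = P.eval (p : ℚ) := by
  -- The constants are d₂ = 1 and d₃ = 2, and the last argument is dim φ(V) for V ≤ L₁ of dimension
  -- m.
  choose S hS using fun m : ℕ => sum_innerSum_polynomial 1 2 a m (if m = 0 then 0 else 1)
  choose G hG using fun m : ℕ => gaussBinom_polynomial 2 m
  refine ⟨∑ m ∈ range 3, G m * S m, fun c p _ hc => ?_⟩
  classical
  have hp2 : 2 ≤ p := (Fact.out : p.Prime).two_le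
  have h2 : layerDim p c (1 + 2) = 2 * layerDim p c (1 + 1) := by
    rw [layerDim_three hc, layerDim_two hc]
  rw [alpha2_eq_sum (fun V hV => finrank_phiSum_of_layerDim p c h2 hV)]
  have hterm : ∀ V ∈ ({V | V ≤ layer p c 1} : Finset (Submodule (ZMod p) (FreeNilp p c))),
      extensionCount p c 1 a (Module.finrank (ZMod p) V)
        (Module.finrank (ZMod p) (phiSum p c V)) =
        (S (Module.finrank (ZMod p) V)).eval (p : ℚ) := by
    intro V hV
    rw [← hS _ p hp2, extensionCount, finrank_phiSum_of_le_layer_one hc (Finset.mem_filter.1 hV).2,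
      layerDim_two hc, layerDim_three hc]
    push_cast
    rfl
  rw [Finset.sum_congr rfl hterm, sum_eq_sum_card_fiber_mul _
    (fun V : Submodule (ZMod p) (FreeNilp p c) => Module.finrank (ZMod p) V) 3 _
    (fun m => (S m).eval (p : ℚ)), Polynomial.eval_finsetSum]
  · refine Finset.sum_congr rfl fun m _ => ?_
    rw [Polynomial.eval_mul, ← hG m p hp2]
    congr 1
    have := ncard_subspaces_le (layer p c 1) m
    rw [ZMod.card, show Module.finrank (ZMod p) (layer p c 1) = 2 from layerDim_one hc,
      ncard_setOf_eq_card_filter] at this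
    rw [Finset.filter_filter]
    exact_mod_cast this
  · intro V hV
    have := Submodule.finrank_mono (Finset.mem_filter.1 hV).2
    rw [show Module.finrank (ZMod p) (layer p c 1) = 2 from layerDim_one hc] at this
    omega

end Formulas

end TwoStep

end

theorem mainTheorem7 (k : ℕ) (hk : k = 1 ∨ k = 3 ∨ k = 5) (a : ℕ) :
    (∀ c p : ℕ, k + 2 ≤ c → p.Prime → c ≤ p →
      TwoStep.LambdaSucc p c (k + 1) = ⊥ ∧
      (k ≠ 1 →
        (TwoStep.alpha2 p c k a : ℚ) =
          ∑ m ∈ Finset.range (TwoStep.layerDim p c k + 1),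
            ∑ i ∈ Finset.range (TwoStep.lSucc p c k + 1),
              (TwoStep.f p c k m i : ℚ) * TwoStep.innerSum p c k a m i) ∧
      (TwoStep.alpha2 p c k a : ℚ) =
        ∑ m ∈ Finset.range (TwoStep.layerDim p c k + 1),
          ∑ i ∈ Finset.range (2 * m + 1),
            (TwoStep.fDefect p c k m i : ℚ) * TwoStep.innerSum p c k a m i) ∧
    ∃ P : Polynomial ℚ, ∀ c p : ℕ, k + 2 ≤ c → p.Prime → c ≤ p →
      (TwoStep.alpha2 p c k a : ℚ) = P.eval (p : ℚ) := by
  constructor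
  · intro c p hkc hp hcp
    have : Fact p.Prime := ⟨hp⟩
    have h2 := TwoStep.layerDim_eq_two_mul hk hkc hcp
    refine ⟨TwoStep.LambdaSucc_eq_bot p c h2, fun hk1 => ?_, TwoStep.alpha2_eq_sum_fDefect h2 a⟩
    rcases hk with rfl | rfl | rfl
    · exact absurd rfl hk1
    · obtain ⟨A, B, h⟩ := TwoStep.exists_isPresentation_three (p := p) hkc
      exact h.alpha2_eq_sum_f a
    · obtain ⟨A, B, h⟩ := TwoStep.exists_isPresentation_five (p := p) hkc (hkc.trans hcp)
      exact h.alpha2_eq_sum_f a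
  · rcases hk with rfl | rfl | rfl
    · obtain ⟨P, hP⟩ := TwoStep.alpha2_one_polynomial a
      refine ⟨P, fun c p hkc hp _ => ?_⟩
      have : Fact p.Prime := ⟨hp⟩
      exact hP c p hkc
    · obtain ⟨P, hP⟩ := TwoStep.IsPresentation.alpha2_polynomial 3 1 a
      refine ⟨P, fun c p hkc hp _ => ?_⟩
      have : Fact p.Prime := ⟨hp⟩
      obtain ⟨A, B, h⟩ := TwoStep.exists_isPresentation_three (p := p) hkc
      exact hP c p A B h
    · obtain ⟨P, hP⟩ := TwoStep.IsPresentation.alpha2_polynomial 5 3 a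
      refine ⟨P, fun c p hkc hp hcp => ?_⟩
      have : Fact p.Prime := ⟨hp⟩
      obtain ⟨A, B, h⟩ := TwoStep.exists_isPresentation_five (p := p) hkc (hkc.trans hcp)
      exact hP c p A B h
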